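/- Let $G$ be a locally compact (Hausdorff) abelian group, written additively, with a Haar measure $dx$ and dual group $\widehat G$ (the continuous characters $\chi:G\to S^1$ with the compact-open topology). Let $L^1(G)$ be the convolution algebra with product $(f\star g)(x)=\int_G f(x-y)g(y)\,dy$. For $f\in L^1(G)$ let $\Psi_f$ be the bounded operator on $L^2(G)$ determined by $$\langle\phi\,|\,\Psi_f\varphi\rangle=\int_G f(y)\,\langle\phi\,|\,T_y\varphi\rangle\,dy\qquad(\phi,\varphi\in L^2(G)),$$ where $T_y\varphi(x)=\varphi(x-y)$ and the inner product is conjugate-linear in the first variable (so $\Psi_f\varphi=f\star\varphi$ for $\varphi\in L^1(G)\cap L^2(G)$). Let $C^*(G)$ be the operator-norm closure of $\{\Psi_f: f\in L^1(G)\}$ in $\mathcal B(L^2(G))$. For $\mathcal A=L^1(G)$ or $\mathcal A=C^*(G)$ let $\Delta_{\mathcal A}$ be the set of non-zero continuous multiplicative linear functionals $m:\mathcal A\to\mathbb C$ with the topology of pointwise convergence on $\mathcal A$. Then the following maps exist. 1. $M:\widehat G\to\Delta_{L^1(G)}$, $M(\chi)(f)=\widehat f(\chi)=\int_G f(x)\overline{\chi(x)}\,dx$,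 is a well-defined homeomorphism. 2. $\Psi_\Delta:\Delta_{C^*(G)}\to\Delta_{L^1(G)}$, $\Psi_\Delta(m)(f)=m(\Psi_f)$, is a well-defined homeomorphism. 3. The Gelfand transform $\Gamma:C^*(G)\to C_0(\Delta_{C^*(G)})$, $\Gamma(a)(m)=m(a)$, is an isometric $*$-isomorphism. 4. There is an isometric $*$-isomorphism $\Omega:C_0(\widehat G)\to C^*(G)$ with $\Gamma(\Omega(F))=F\circ M^{-1}\circ\Psi_\Delta$ for all $F\in C_0(\widehat G)$; that is, $\Omega=\Gamma^{-1}\circ\Theta$ with $\Theta(F)=F\circ M^{-1}\circ\Psi_\Delta$. -/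

import Mathlib

open MeasureTheory Topology
open scoped ENNReal ComplexConjugate InnerProductSpace ZeroAtInfty

noncomputable section

namespace LCA

section Translation

variable {G : Type*} [AddCommGroup G] [TopologicalSpace G] [IsTopologicalAddGroup G]
  [MeasurableSpace G] [BorelSpace G] (μ : Measure G) [μ.IsAddHaarMeasure]

/-- The translation operator `(T_y φ)(x) = φ (x - y)` on `L²(G)`. -/
def translation (y : G) : Lp ℂ 2 μ →ₗᵢ[ℂ] Lp ℂ 2 μ :=
  Lp.compMeasurePreservingₗᵢ ℂ (fun x => x - y) (measurePreserving_sub_right μ y)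

theorem translation_ae (y : G) (φ : Lp ℂ 2 μ) :
    translation μ y φ =ᵐ[μ] fun x => φ (x - y) :=
  Lp.coeFn_compMeasurePreserving _ _

theorem translation_add (y z : G) (φ : Lp ℂ 2 μ) :
    translation μ (y + z) φ = translation μ y (translation μ z φ) := by
  refine Lp.ext ?_
  filter_upwards [translation_ae μ (y + z) φ, translation_ae μ y (translation μ z φ),
    (measurePreserving_sub_right μ y).quasiMeasurePreserving.ae (translation_ae μ z φ)]
    with x h1 h2 h3
  rw [h1, h2, h3]
  congr 1
  abel

theorem translation_zero (φ : Lp ℂ 2 μ) : translation μ 0 φ = φ := by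
  refine Lp.ext ?_
  filter_upwards [translation_ae μ 0 φ] with x h1
  rw [h1, sub_zero]

theorem inner_translation (y : G) (φ ψ : Lp ℂ 2 μ) :
    ⟪translation μ y φ, ψ⟫_ℂ = ⟪φ, translation μ (-y) ψ⟫_ℂ := by
  rw [← (translation μ (-y)).inner_map_map (translation μ y φ) ψ, ← translation_add,
    neg_add_cancel, translation_zero]

variable [LocallyCompactSpace G] [μ.Regular]

theorem continuous_translation (φ : Lp ℂ 2 μ) : Continuous fun y : G => translation μ y φ := by
  have h : (fun y : G => translation μ y φ) = fun y : G => DomAddAct.mk (-y) +ᵥ φ := by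
    funext y
    refine Lp.ext ?_
    filter_upwards [translation_ae μ y φ, DomAddAct.vadd_Lp_ae_eq (DomAddAct.mk (-y)) φ]
      with x h1 h2
    rw [h1, h2]
    simp [sub_eq_neg_add]
  rw [h]
  have : Fact ((2 : ℝ≥0∞) ≠ ∞) := ⟨by simp⟩
  exact (DomAddAct.continuous_mk.comp continuous_neg).vadd continuous_const

theorem integrable_mul_inner_translation {f : G → ℂ} (hf : Integrable f μ) (φ ψ : Lp ℂ 2 μ) :
    Integrable (fun y => f y * ⟪φ, translation μ y ψ⟫_ℂ) μ := by
  refine hf.mul_bdd (c := ‖φ‖ * ‖ψ‖) ?_ ?_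
  · exact (continuous_const.inner (continuous_translation μ ψ)).aestronglyMeasurable
  · refine Filter.Eventually.of_forall fun y => ?_
    simpa using norm_inner_le_norm φ (translation μ y ψ)

/-- The sesquilinear form `(φ, ψ) ↦ ∫ f(y) ⟪φ, T_y ψ⟫ dy`. -/
def convForm (f : Lp ℂ 1 μ) : Lp ℂ 2 μ →L⋆[ℂ] Lp ℂ 2 μ →L[ℂ] ℂ :=
  LinearMap.mkContinuous₂
    (LinearMap.mk₂'ₛₗ (starRingEnd ℂ) (RingHom.id ℂ)
      (fun φ ψ => ∫ y, f y * ⟪φ, translation μ y ψ⟫_ℂ ∂μ)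
      (fun φ₁ φ₂ ψ => by
        rw [← integral_add (integrable_mul_inner_translation μ (L1.integrable_coeFn f) _ _)
          (integrable_mul_inner_translation μ (L1.integrable_coeFn f) _ _)]
        simp only [inner_add_left, mul_add])
      (fun c φ ψ => by
        rw [smul_eq_mul, ← integral_const_mul]
        simp only [inner_smul_left, mul_left_comm])
      (fun φ ψ₁ ψ₂ => by
        rw [← integral_add (integrable_mul_inner_translation μ (L1.integrable_coeFn f) _ _)
          (integrable_mul_inner_translation μ (L1.integrable_coeFn f) _ _)]
        simp only [map_add, inner_add_right, mul_add])
      (fun c φ ψ => by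
        rw [RingHom.id_apply, smul_eq_mul, ← integral_const_mul]
        simp only [map_smul, inner_smul_right, mul_left_comm]))
    ‖f‖ (fun φ ψ => by
      rw [LinearMap.mk₂'ₛₗ_apply, L1.norm_eq_integral_norm, mul_assoc, ← integral_mul_const]
      refine norm_integral_le_of_norm_le ((L1.integrable_coeFn f).norm.mul_const _)
        (Filter.Eventually.of_forall fun y => ?_)
      rw [norm_mul]
      gcongr
      simpa using norm_inner_le_norm φ (translation μ y ψ))

/-- The convolution operator `Ψ_f` on `L²(G)`: for `ψ ∈ L²(G)`, the vector `Ψ_f ψ` is the one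
representing the functional `φ ↦ ∫ f(y) ⟪φ, T_y ψ⟫ dy`, see `inner_convOp`. -/
def convOp (f : Lp ℂ 1 μ) : Lp ℂ 2 μ →L[ℂ] Lp ℂ 2 μ :=
  ContinuousLinearMap.adjoint (InnerProductSpace.continuousLinearMapOfBilin (convForm μ f))

theorem inner_convOp (f : Lp ℂ 1 μ) (φ ψ : Lp ℂ 2 μ) :
    ⟪φ, convOp μ f ψ⟫_ℂ = ∫ y, f y * ⟪φ, translation μ y ψ⟫_ℂ ∂μ := by
  rw [convOp, ContinuousLinearMap.adjoint_inner_right,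
    InnerProductSpace.continuousLinearMapOfBilin_apply]
  rfl

end Translation

section Convolution

theorem hasSum_mul {a b : ℕ → ℂ} {s t : ℂ} (ha : HasSum a s) (hb : HasSum b t) :
    HasSum (fun p : ℕ × ℕ => a p.1 * b p.2) (s * t) :=
  ha.mul hb (summable_mul_of_summable_norm ha.summable.norm hb.summable.norm)

theorem hasSum_integral_aux {X ι : Type*} [MeasurableSpace X] {μ : Measure X} [Countable ι]
    {F : ι → X → ℂ} (hF : ∀ i, Integrable (F i) μ) (hs : Summable fun i => ∫ x, ‖F i x‖ ∂μ) :
    ∀ᵐ x ∂μ, Summable fun i => F i x := by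
  have h1 : ∫⁻ x, ∑' i, ‖F i x‖ₑ ∂μ ≠ ∞ := by
    rw [lintegral_tsum fun i => (hF i).1.enorm]
    have : ∀ i, ∫⁻ x, ‖F i x‖ₑ ∂μ = ENNReal.ofReal (∫ x, ‖F i x‖ ∂μ) := fun i =>
      (ofReal_integral_norm_eq_lintegral_enorm (hF i)).symm
    simp_rw [this]
    exact hs.tsum_ofReal_ne_top
  filter_upwards [ae_lt_top' (AEMeasurable.tsum fun i => (hF i).1.enorm) h1] with x hx
  refine Summable.of_norm ?_
  have h2 := ENNReal.summable_toReal hx.ne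
  simpa using h2

theorem hasSum_integral {X ι : Type*} [MeasurableSpace X] {μ : Measure X} [Countable ι]
    {F : ι → X → ℂ} {f : X → ℂ} (hF : ∀ i, Integrable (F i) μ)
    (hs : Summable fun i => ∫ x, ‖F i x‖ ∂μ)
    (hf : ∀ᵐ x ∂μ, HasSum (fun i => F i x) (f x)) :
    Integrable f μ ∧ HasSum (fun i => ∫ x, F i x ∂μ) (∫ x, f x ∂μ) := by
  constructor
  · refine ⟨?_, ?_⟩
    · refine aestronglyMeasurable_of_tendsto_ae Filter.atTop
        (f := fun (s : Finset ι) x => ∑ i ∈ s, F i x) (fun s => ?_) hf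
      exact Finset.aestronglyMeasurable_fun_sum s fun i _ => (hF i).1
    · have h1 : ∫⁻ x, ‖f x‖ₑ ∂μ ≤ ∫⁻ x, ∑' i, ‖F i x‖ₑ ∂μ := by
        refine lintegral_mono_ae ?_
        filter_upwards [hf] with x hx
        rw [← hx.tsum_eq]
        exact enorm_tsum_le_tsum_enorm
      refine h1.trans_lt ?_
      rw [lintegral_tsum fun i => (hF i).1.enorm]
      have : ∀ i, ∫⁻ x, ‖F i x‖ₑ ∂μ = ENNReal.ofReal (∫ x, ‖F i x‖ ∂μ) := fun i =>
        (ofReal_integral_norm_eq_lintegral_enorm (hF i)).symm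
      simp_rw [this]
      exact hs.tsum_ofReal_ne_top.lt_top
  · have h := hasSum_integral_of_summable_integral_norm hF hs
    rwa [integral_congr_ae (g := f) (hf.mono fun x hx => hx.tsum_eq)] at h

variable {G : Type*} [AddCommGroup G] [TopologicalSpace G] [IsTopologicalAddGroup G]
  [LocallyCompactSpace G] [T2Space G] [MeasurableSpace G] [BorelSpace G]
  (μ : Measure G) [μ.IsAddHaarMeasure]

/-- The convolution of compactly supported continuous functions. -/
theorem conv_continuous {𝕜 : Type*} [RCLike 𝕜] {d e : G → 𝕜} (hd : Continuous d)
    (hd' : HasCompactSupport d) (he : Continuous e) (he' : HasCompactSupport e) :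
    Continuous (fun x => ∫ y, d (x - y) * e y ∂μ) ∧
      HasCompactSupport (fun x => ∫ y, d (x - y) * e y ∂μ) ∧
      ∀ k : G → 𝕜, Continuous k →
        ∫ x, (∫ y, d (x - y) * e y ∂μ) * k x ∂μ =
          ∫ y, e y * ∫ x, d x * k (x + y) ∂μ ∂μ := by
  have h : (fun x => ∫ y, d (x - y) * e y ∂μ) =
      MeasureTheory.convolution e d (ContinuousLinearMap.mul ℝ 𝕜) μ := by
    funext x
    simp [MeasureTheory.convolution, mul_comm]
  refine ⟨?_, ?_, fun k hk => ?_⟩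
  · rw [h]
    exact hd'.continuous_convolution_right _ (he.integrable_of_hasCompactSupport
      he').locallyIntegrable hd
  · rw [h]
    exact he'.convolution _ hd'
  · simp_rw [← integral_mul_const]
    rw [integral_integral_swap_of_hasCompactSupport]
    · congr 1
      funext y
      rw [← integral_sub_right_eq_self (fun x => d x * k (x + y)) y, ← integral_const_mul]
      congr 1
      funext x
      rw [sub_add_cancel]
      ring
    · simp only [Function.uncurry_def]
      fun_prop
    · refine HasCompactSupport.of_support_subset_isCompact
        ((IsCompact.add hd' he').prod he') ?_
      rintro ⟨x, y⟩ hxy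
      simp only [Function.uncurry_def, Function.mem_support, ne_eq, mul_eq_zero, not_or] at hxy
      have hy : y ∈ tsupport e := subset_tsupport _ hxy.1.2
      exact ⟨⟨x - y, subset_tsupport _ hxy.1.1, y, hy, sub_add_cancel x y⟩, hy⟩

theorem conv_norm {d e : G → ℂ} (hd : Continuous d)
    (hd' : HasCompactSupport d) (he : Continuous e) (he' : HasCompactSupport e) :
    Integrable (fun x => ∫ y, ‖d (x - y)‖ * ‖e y‖ ∂μ) μ ∧
      ∫ x, (∫ y, ‖d (x - y)‖ * ‖e y‖ ∂μ) ∂μ = (∫ x, ‖d x‖ ∂μ) * ∫ y, ‖e y‖ ∂μ := by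
  obtain ⟨h1, h2, h3⟩ := conv_continuous μ hd.norm hd'.norm he.norm he'.norm
  refine ⟨h1.integrable_of_hasCompactSupport h2, ?_⟩
  have := h3 (fun _ => 1) continuous_const
  simp only [mul_one] at this
  rw [this, integral_mul_const, mul_comm]

variable [μ.Regular]

/-- Compactly supported continuous functions are dense in `L^p`. -/
theorem exists_approx {p : ℝ≥0∞} (hp : p ≠ ∞) {f : G → ℂ} (hf : MemLp f p μ)
    {ε : ℝ≥0∞} (hε : ε ≠ 0) :
    ∃ g : G → ℂ, eLpNorm (f - g) p μ ≤ ε ∧ Continuous g ∧ HasCompactSupport g := by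
  refine hf.induction_dense hp (fun g => Continuous g ∧ HasCompactSupport g) ?_
    ?_ (fun f hf => hf.1.aestronglyMeasurable) hε
  rotate_left
  · rintro f g ⟨hf1, hf2⟩ ⟨hg1, hg2⟩
    exact ⟨hf1.add hg1, HasCompactSupport.add hf2 hg2⟩
  intro c t ht htμ ε hε
  obtain ⟨η, ηpos, hη⟩ := exists_eLpNorm_indicator_le (μ := μ) hp c hε
  have hη2 : ((η / 2 : NNReal) : ℝ≥0∞) ≠ 0 := by
    rw [ENNReal.coe_ne_zero]
    positivity
  obtain ⟨s, st, s_compact, s_closed, μs⟩ := ht.exists_isCompact_isClosed_sdiff_lt htμ.ne hη2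
  have hsμ : μ s < ∞ := (measure_mono st).trans_lt htμ
  obtain ⟨u, su, u_open, hu⟩ := s.exists_isOpen_lt_add hsμ.ne hη2
  have hus : μ (u \ s) ≤ (η / 2 : NNReal) := by
    rw [measure_sdiff su s_closed.nullMeasurableSet hsμ.ne]
    exact tsub_le_iff_left.2 hu.le
  obtain ⟨k, hk1, hk2, hk3, hk4⟩ := exists_continuous_one_zero_of_isCompact s_compact
    u_open.isClosed_compl (Set.disjoint_compl_right_iff_subset.2 su)
  refine ⟨fun x => (k x : ℂ) * c, ?_, by fun_prop, ?_⟩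
  · refine le_trans (eLpNorm_mono fun x => ?_) (hη ((u \ s) ∪ (t \ s)) ?_)
    · have hk5 : |k x| ≤ 1 := abs_le.2 ⟨by linarith [(hk4 x).1], (hk4 x).2⟩
      have hk6 : |k x - 1| ≤ 1 := abs_le.2 ⟨by linarith [(hk4 x).1], by linarith [(hk4 x).2]⟩
      by_cases hxs : x ∈ s
      · simp [hxs, st hxs, hk1 hxs]
      · by_cases hxu : x ∈ u
        · by_cases hxt : x ∈ t
          · have : (k x : ℂ) * c - c = ((k x - 1 : ℝ) : ℂ) * c := by push_cast; ring
            simp only [Pi.sub_apply, Set.indicator, hxt, if_true, Set.mem_union, Set.mem_sdiff, hxu,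
              hxs, not_false_eq_true, and_self, or_self, this, norm_mul, Complex.norm_real,
              Real.norm_eq_abs]
            exact mul_le_of_le_one_left (norm_nonneg _) hk6
          · simp only [Pi.sub_apply, Set.indicator, hxt, if_true, Set.mem_union, Set.mem_sdiff, hxu,
              hxs, not_false_eq_true, and_self, norm_mul, Complex.norm_real,
              Real.norm_eq_abs, true_or, if_false, sub_zero]
            exact mul_le_of_le_one_left (norm_nonneg _) hk5
        · have : k x = 0 := hk2 hxu
          by_cases hxt : x ∈ t <;> simp [Set.indicator, hxt, hxu, hxs, this]
    · refine (measure_union_le _ _).trans ((add_le_add hus μs.le).trans ?_)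
      rw [← ENNReal.coe_add, add_halves]
  · refine HasCompactSupport.mul_right (hk3.comp_left (g := fun r : ℝ => (r : ℂ)) ?_)
    simp

theorem exists_decomposition {f : G → ℂ} (hf : Integrable f μ) :
    ∃ d : ℕ → G → ℂ, (∀ n, Continuous (d n)) ∧ (∀ n, HasCompactSupport (d n)) ∧
      (Summable fun n => ∫ x, ‖d n x‖ ∂μ) ∧ ∀ᵐ x ∂μ, HasSum (fun n => d n x) (f x) := by
  have key : ∀ n : ℕ, ∃ u : G → ℂ, HasCompactSupport u ∧
      (∫ x, ‖f x - u x‖ ∂μ) ≤ (1 / 2) ^ n ∧ Continuous u ∧ Integrable u μ := by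
    intro n
    have hn : (0 : ℝ) < (1 / 2) ^ n := by positivity
    obtain ⟨u, h1, h2, h3⟩ := exists_approx μ ENNReal.one_ne_top
      (memLp_one_iff_integrable.2 hf) (ENNReal.ofReal_pos.2 hn).ne'
    have h4 := h2.integrable_of_hasCompactSupport (μ := μ) h3
    refine ⟨u, h3, ?_, h2, h4⟩
    rw [eLpNorm_one_eq_lintegral_enorm, ← ofReal_integral_norm_eq_lintegral_enorm (hf.sub h4)] at h1
    exact (ENNReal.ofReal_le_ofReal_iff hn.le).1 h1
  choose u hu1 hu2 hu3 hu4 using key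
  let d : ℕ → G → ℂ := fun n => Nat.casesOn n (u 0) fun m => u (m + 1) - u m
  have hd1 : ∀ n, Continuous (d n) := by
    rintro (_ | n)
    · exact hu3 0
    · exact (hu3 _).sub (hu3 _)
  have hd2 : ∀ n, HasCompactSupport (d n) := by
    rintro (_ | n)
    · exact hu1 0
    · exact (hu1 _).sub (hu1 _)
  have hg : Summable fun n : ℕ => ((1 : ℝ) / 2) ^ n := summable_geometric_two
  have hd3 : Summable fun n => ∫ x, ‖d n x‖ ∂μ := by
    rw [← summable_nat_add_iff 1]
    refine Summable.of_nonneg_of_le (fun n => by positivity) (fun n => ?_)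
      (((summable_nat_add_iff 1).2 hg).add hg)
    refine le_trans ?_ (add_le_add (hu2 (n + 1)) (hu2 n))
    rw [← integral_add (f := fun x => ‖f x - u (n + 1) x‖) (g := fun x => ‖f x - u n x‖)
      (hf.sub (hu4 _)).norm (hf.sub (hu4 _)).norm]
    refine integral_mono ((hu4 _).sub (hu4 _)).norm
      ((hf.sub (hu4 _)).norm.add (hf.sub (hu4 _)).norm) fun x => ?_
    have : d (n + 1) x = (f x - u n x) - (f x - u (n + 1) x) := by
      simp [d]
    simp only [this]
    exact (norm_sub_le _ _).trans (add_comm _ _).le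
  refine ⟨d, hd1, hd2, hd3, ?_⟩
  have hs : Summable fun n => ∫ x, ‖(f - u n) x‖ ∂μ :=
    Summable.of_nonneg_of_le (fun n => by positivity) hu2 hg
  filter_upwards [hasSum_integral_aux (fun n => hf.sub (hu4 n)) hs,
    hasSum_integral_aux
      (fun n => (hd1 n).integrable_of_hasCompactSupport (μ := μ) (hd2 n)) hd3] with x h1 h2
  have hsum : ∀ n, ∑ i ∈ Finset.range (n + 1), d i x = u n x := by
    intro n
    induction n with
    | zero => simp [d]
    | succ n ih => rw [Finset.sum_range_succ, ih]; simp [d]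
  have h3 : Filter.Tendsto (fun n => u n x) Filter.atTop (𝓝 (f x)) := by
    have := (tendsto_const_nhds (x := f x)).sub h1.tendsto_atTop_zero
    simpa using this
  have h4 := (Filter.tendsto_add_atTop_iff_nat 1).2 h2.hasSum.tendsto_sum_nat
  simp only [hsum] at h4
  rw [← tendsto_nhds_unique h4 h3]
  exact h2.hasSum

/-- The convolution of two integrable functions is integrable, and Fubini's theorem holds. -/
theorem conv_main {f g : G → ℂ} (hf : Integrable f μ) (hg : Integrable g μ) :
    Integrable (fun x => ∫ y, f (x - y) * g y ∂μ) μ ∧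
      ∀ k : G → ℂ, Continuous k → ∀ C : ℝ, (∀ x, ‖k x‖ ≤ C) →
        ∫ x, (∫ y, f (x - y) * g y ∂μ) * k x ∂μ =
          ∫ y, g y * ∫ x, f x * k (x + y) ∂μ ∂μ := by
  obtain ⟨d, hd1, hd2, hd3, hd4⟩ := exists_decomposition μ hf
  obtain ⟨e, he1, he2, he3, he4⟩ := exists_decomposition μ hg
  have hde : Summable fun p : ℕ × ℕ => (∫ x, ‖d p.1 x‖ ∂μ) * ∫ x, ‖e p.2 x‖ ∂μ :=
    hd3.mul_of_nonneg he3 (fun n => by positivity) (fun n => by positivity)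
  have hc1 := fun p : ℕ × ℕ => conv_norm μ (hd1 p.1) (hd2 p.1) (he1 p.2) (he2 p.2)
  have hc2 := fun p : ℕ × ℕ => conv_continuous μ (hd1 p.1) (hd2 p.1) (he1 p.2) (he2 p.2)
  have hle : ∀ (p : ℕ × ℕ) (x : G), ‖∫ y, d p.1 (x - y) * e p.2 y ∂μ‖ ≤
      ∫ y, ‖d p.1 (x - y)‖ * ‖e p.2 y‖ ∂μ := fun p x => by
    refine (norm_integral_le_integral_norm _).trans_eq ?_
    simp only [norm_mul]
  have hdi : ∀ n, Integrable (d n) μ := fun n => (hd1 n).integrable_of_hasCompactSupport (hd2 n)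
  have hei : ∀ n, Integrable (e n) μ := fun n => (he1 n).integrable_of_hasCompactSupport (he2 n)
  have hci : ∀ p : ℕ × ℕ, Integrable (fun x => ∫ y, d p.1 (x - y) * e p.2 y ∂μ) μ := fun p =>
    (hc2 p).1.integrable_of_hasCompactSupport (hc2 p).2.1
  have hcn : ∀ p : ℕ × ℕ, ∫ x, ‖∫ y, d p.1 (x - y) * e p.2 y ∂μ‖ ∂μ ≤
      (∫ x, ‖d p.1 x‖ ∂μ) * ∫ x, ‖e p.2 x‖ ∂μ := fun p => by
    rw [← (hc1 p).2]
    exact integral_mono (hci p).norm (hc1 p).1 (hle p)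
  have hae : ∀ᵐ x ∂μ, HasSum (fun p : ℕ × ℕ => ∫ y, d p.1 (x - y) * e p.2 y ∂μ)
      (∫ y, f (x - y) * g y ∂μ) := by
    have hsum : ∀ᵐ x ∂μ, Summable fun p : ℕ × ℕ =>
        ((∫ y, ‖d p.1 (x - y)‖ * ‖e p.2 y‖ ∂μ : ℝ) : ℂ) := by
      refine hasSum_integral_aux (fun p => (hc1 p).1.ofReal) ?_
      refine hde.congr fun p => ?_
      rw [← (hc1 p).2]
      refine integral_congr_ae (Filter.Eventually.of_forall fun x => ?_)
      have : 0 ≤ ∫ y, ‖d p.1 (x - y)‖ * ‖e p.2 y‖ ∂μ := by positivity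
      simp [abs_of_nonneg this]
    filter_upwards [hsum] with x hx
    refine (hasSum_integral (fun p => ?_) ?_ ?_).2
    · refine Continuous.integrable_of_hasCompactSupport ?_ (he2 p.2).mul_left
      exact ((hd1 p.1).comp (continuous_const.sub continuous_id)).mul (he1 p.2)
    · simp only [norm_mul]
      exact_mod_cast hx
    · have hd5 : ∀ᵐ y ∂μ, HasSum (fun n => d n (x - y)) (f (x - y)) :=
        (Measure.measurePreserving_sub_left μ x).quasiMeasurePreserving.ae hd4
      filter_upwards [he4, hd5] with y h1 h2
      have h3 := hasSum_mul h2 h1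
      exact h3
  refine ⟨(hasSum_integral hci
    (Summable.of_nonneg_of_le (fun p => by positivity) hcn hde) hae).1, fun k hk C hC => ?_⟩
  have hC0 : 0 ≤ C := (norm_nonneg _).trans (hC 0)
  have hmulk : ∀ {u : G → ℂ} (y : G), Integrable u μ →
      Integrable (fun x => u x * k (x + y)) μ := fun y hu =>
    hu.mul_bdd (c := C) (hk.comp (continuous_add_const y)).aestronglyMeasurable
      (Filter.Eventually.of_forall fun x => hC _)
  have hlek : ∀ {u : G → ℂ} (y : G), Integrable u μ →
      ∫ x, ‖u x * k (x + y)‖ ∂μ ≤ (∫ x, ‖u x‖ ∂μ) * C := fun y hu => by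
    rw [← integral_mul_const]
    refine integral_mono (hmulk y hu).norm (hu.norm.mul_const C) fun x => ?_
    simp only [norm_mul]
    exact mul_le_mul_of_nonneg_left (hC _) (norm_nonneg _)
  have hL : HasSum (fun p : ℕ × ℕ => ∫ x, (∫ y, d p.1 (x - y) * e p.2 y ∂μ) * k x ∂μ)
      (∫ x, (∫ y, f (x - y) * g y ∂μ) * k x ∂μ) := by
    refine (hasSum_integral (fun p => by simpa using hmulk 0 (hci p)) ?_ ?_).2
    · refine Summable.of_nonneg_of_le (fun p => by positivity) (fun p => ?_) (hde.mul_right C)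
      have := hlek 0 (hci p)
      simp only [add_zero] at this
      exact this.trans (mul_le_mul_of_nonneg_right (hcn p) hC0)
    · filter_upwards [hae] with x hx
      exact hx.mul_right _
  have hK : ∀ n, Continuous fun y => ∫ x, d n x * k (x + y) ∂μ := fun n => by
    have h : (fun y => ∫ x, d n x * k (x + y) ∂μ) =
        MeasureTheory.convolution k (fun x => d n (-x)) (ContinuousLinearMap.mul ℝ ℂ) μ := by
      funext y
      rw [← integral_sub_right_eq_self (fun x => d n x * k (x + y)) y]
      simp [MeasureTheory.convolution, mul_comm]
    rw [h]
    exact ((hd2 n).comp_homeomorph (Homeomorph.neg G)).continuous_convolution_right _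
      hk.locallyIntegrable ((hd1 n).comp continuous_neg)
  have hKn : ∀ n y, ‖∫ x, d n x * k (x + y) ∂μ‖ ≤ (∫ x, ‖d n x‖ ∂μ) * C := fun n y =>
    (norm_integral_le_integral_norm _).trans (hlek y (hdi n))
  have hKi : ∀ p : ℕ × ℕ, Integrable (fun y => e p.2 y * ∫ x, d p.1 x * k (x + y) ∂μ) μ :=
    fun p => (hei p.2).mul_bdd (hK p.1).aestronglyMeasurable
      (Filter.Eventually.of_forall fun y => hKn p.1 y)
  have hR : HasSum (fun p : ℕ × ℕ => ∫ y, e p.2 y * ∫ x, d p.1 x * k (x + y) ∂μ ∂μ)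
      (∫ y, g y * ∫ x, f x * k (x + y) ∂μ ∂μ) := by
    refine (hasSum_integral hKi ?_ ?_).2
    · refine Summable.of_nonneg_of_le (fun p => by positivity) (fun p => ?_) (hde.mul_right C)
      rw [mul_right_comm, mul_comm _ (∫ x, ‖e p.2 x‖ ∂μ), ← integral_mul_const]
      refine integral_mono (hKi p).norm ((hei p.2).norm.mul_const _) fun y => ?_
      simp only [norm_mul]
      exact mul_le_mul_of_nonneg_left (hKn p.1 y) (norm_nonneg _)
    · filter_upwards [he4] with y hy
      have h1 : HasSum (fun n => ∫ x, d n x * k (x + y) ∂μ) (∫ x, f x * k (x + y) ∂μ) := by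
        refine (hasSum_integral (fun n => hmulk y (hdi n)) ?_ ?_).2
        · exact Summable.of_nonneg_of_le (fun n => by positivity) (fun n => hlek y (hdi n))
            (hd3.mul_right C)
        · filter_upwards [hd4] with x hx
          exact hx.mul_right _
      have h2 := hasSum_mul h1 hy
      simpa only [mul_comm] using h2
  refine hL.unique ?_
  convert hR using 2 with p
  exact (hc2 p).2.2 k hk

/-- The convolution product `(f ⋆ g)(x) = ∫ f (x - y) g y dy` on `L¹(G)`. -/
def conv (f g : Lp ℂ 1 μ) : Lp ℂ 1 μ :=
  (conv_main μ (L1.integrable_coeFn f) (L1.integrable_coeFn g)).1.toL1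
    (fun x => ∫ y, f (x - y) * g y ∂μ)

theorem conv_ae (f g : Lp ℂ 1 μ) : conv μ f g =ᵐ[μ] fun x => ∫ y, f (x - y) * g y ∂μ :=
  Integrable.coeFn_toL1 _

end Convolution

section Algebra

variable {G : Type*} [AddCommGroup G] [TopologicalSpace G] [IsTopologicalAddGroup G]
  [LocallyCompactSpace G] [T2Space G] [MeasurableSpace G] [BorelSpace G]
  (μ : Measure G) [μ.IsAddHaarMeasure] [μ.Regular]

theorem convOp_ext {T : Lp ℂ 2 μ →L[ℂ] Lp ℂ 2 μ} {f : Lp ℂ 1 μ}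
    (h : ∀ φ ψ, ⟪φ, T ψ⟫_ℂ = ∫ y, f y * ⟪φ, translation μ y ψ⟫_ℂ ∂μ) : T = convOp μ f :=
  ContinuousLinearMap.ext fun ψ => ext_inner_left ℂ fun φ => by rw [h, inner_convOp]

theorem convOp_add (f g : Lp ℂ 1 μ) : convOp μ f + convOp μ g = convOp μ (f + g) := by
  refine convOp_ext μ fun φ ψ => ?_
  rw [add_apply, inner_add_right, inner_convOp, inner_convOp,
    ← integral_add (integrable_mul_inner_translation μ (L1.integrable_coeFn f) _ _)
      (integrable_mul_inner_translation μ (L1.integrable_coeFn g) _ _)]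
  refine integral_congr_ae ?_
  filter_upwards [Lp.coeFn_add f g] with y hy
  rw [hy, Pi.add_apply, add_mul]

theorem convOp_smul (c : ℂ) (f : Lp ℂ 1 μ) : c • convOp μ f = convOp μ (c • f) := by
  refine convOp_ext μ fun φ ψ => ?_
  rw [smul_apply, inner_smul_right, inner_convOp, ← integral_const_mul]
  refine integral_congr_ae ?_
  filter_upwards [Lp.coeFn_smul c f] with y hy
  rw [hy, Pi.smul_apply, smul_eq_mul, mul_assoc]

theorem convOp_mul (f g : Lp ℂ 1 μ) : convOp μ g * convOp μ f = convOp μ (conv μ f g) := by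
  refine convOp_ext μ fun φ ψ => ?_
  have h := (conv_main μ (L1.integrable_coeFn f) (L1.integrable_coeFn g)).2
    (fun x => ⟪φ, translation μ x ψ⟫_ℂ) (continuous_const.inner (continuous_translation μ ψ))
    (‖φ‖ * ‖ψ‖) (fun x => by simpa using norm_inner_le_norm φ (translation μ x ψ))
  rw [integral_congr_ae (g := fun x => (∫ y, f (x - y) * g y ∂μ) * ⟪φ, translation μ x ψ⟫_ℂ)
    ((conv_ae μ f g).mono fun x hx => by simp only [hx]), h, ContinuousLinearMap.mul_def, ContinuousLinearMap.comp_apply,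
    inner_convOp]
  congr 1
  funext y
  rw [← neg_neg y, ← inner_translation, inner_convOp]
  simp only [inner_translation, neg_neg]
  congr 2
  funext x
  rw [← translation_add, add_comm]

theorem integrable_star {f : G → ℂ} (hf : Integrable f μ) :
    Integrable (fun x => conj (f (-x))) μ :=
  (Complex.conjCLE.toContinuousLinearMap.integrable_comp hf.comp_neg)

/-- The involution `f* (x) = conj (f (-x))` on `L¹(G)`. -/
def involution (f : Lp ℂ 1 μ) : Lp ℂ 1 μ :=
  (integrable_star μ (L1.integrable_coeFn f)).toL1 (fun x => conj (f (-x)))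

theorem star_convOp (f : Lp ℂ 1 μ) : star (convOp μ f) = convOp μ (involution μ f) := by
  refine convOp_ext μ fun φ ψ => ?_
  rw [ContinuousLinearMap.star_eq_adjoint, ContinuousLinearMap.adjoint_inner_right,
    ← inner_conj_symm, inner_convOp, ← integral_conj, ← integral_neg_eq_self]
  refine integral_congr_ae ?_
  filter_upwards [Integrable.coeFn_toL1 (integrable_star μ (L1.integrable_coeFn f))] with y hy
  rw [involution, hy, map_mul, inner_conj_symm, inner_translation, neg_neg]

/-- The image `Ψ(L¹(G))`, a `*`-subalgebra of `B(L²(G))`. -/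
def convOpRange : NonUnitalStarSubalgebra ℂ (Lp ℂ 2 μ →L[ℂ] Lp ℂ 2 μ) where
  carrier := Set.range (convOp μ)
  add_mem' := by
    rintro _ _ ⟨f, rfl⟩ ⟨g, rfl⟩
    exact ⟨f + g, (convOp_add μ f g).symm⟩
  zero_mem' := ⟨0, by simpa using (convOp_smul μ 0 0).symm⟩
  smul_mem' := by
    rintro c _ ⟨f, rfl⟩
    exact ⟨c • f, (convOp_smul μ c f).symm⟩
  mul_mem' := by
    rintro _ _ ⟨f, rfl⟩ ⟨g, rfl⟩
    exact ⟨conv μ g f, (convOp_mul μ g f).symm⟩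
  star_mem' := by
    rintro _ ⟨f, rfl⟩
    exact ⟨involution μ f, (star_convOp μ f).symm⟩

/-- The group C*-algebra `C*(G)`: the operator-norm closure of `Ψ(L¹(G))` in `B(L²(G))`. -/
def groupCStar : NonUnitalStarSubalgebra ℂ (Lp ℂ 2 μ →L[ℂ] Lp ℂ 2 μ) :=
  (convOpRange μ).topologicalClosure

/-- The map `Ψ : L¹(G) → C*(G)`, `f ↦ Ψ_f`. -/
def Psi (f : Lp ℂ 1 μ) : groupCStar μ :=
  ⟨convOp μ f, (convOpRange μ).le_topologicalClosure ⟨f, rfl⟩⟩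

/-- The structure space of the convolution algebra `L¹(G)`: the nonzero continuous multiplicative
linear functionals, with the topology of pointwise convergence on `L¹(G)`. The structure space of
`C*(G)` is `WeakDual.characterSpace ℂ (groupCStar μ)`, with the same topology. -/
def structureSpace : Set (WeakDual ℂ (Lp ℂ 1 μ)) :=
  {m | m ≠ 0 ∧ ∀ f g, m (conv μ f g) = m f * m g}

/-- The Fourier transform `∫ f(x) conj(χ(x)) dx`. -/
def fourier (f : Lp ℂ 1 μ) (χ : PontryaginDual (Multiplicative G)) : ℂ :=
  ∫ x, f x * conj (χ (Multiplicative.ofAdd x) : ℂ) ∂μ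

end Algebra

end LCA

end

/-! The plan is to reduce everything to characters, and to compare those of $L^1(G)$ and $C^*(G)$
without Plancherel's theorem.

Gelfand duality is needed for the possibly non-unital algebra $C^*(G)$. A character of $A$ extends
uniquely to the unitization $A^{+1}$, and the only character not so obtained is the projection to
the scalars. Thus $\Delta_A$ is an open subset of a compact space (`isOpenEmbedding_charExt`), and
both isometry and surjectivity of the Gelfand transform follow from the unital theorem.

For $L^1(G)$, a character $m$ satisfies $m(f)m(g)=\int g(y)\,m(T_yf)\,dy$ (`map_conv`), because
$f\star g$ is an integral of translates of $f$. When $m(f)\ne0$ the quotient $y\mapsto m(T_yf)/m(f)$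
is a bounded continuous homomorphism $G\to\mathbb C^\times$, hence unitary, and $m$ is integration
against it. The same quotient, jointly continuous in $m$ and $y$, gives the continuity of $M^{-1}$.

For $C^*(G)$, every character restricts along $\Psi$ to one of $L^1(G)$. The converse needs
$|\widehat f(\chi)|\le\|\Psi_f\|$ for every $\chi$ (`norm_fourier_le_norm_Psi`). Since $C^*(G)\ne0$,
Gelfand theory provides at least one character, and so the bound at one $\chi_0$. Multiplying $f$ by
a unitary character translates $\widehat f$ and conjugates $\Psi_f$ by a unitary, which carries the
bound from $\chi_0$ to all $\chi$. Each $f\mapsto\widehat f(\chi)$ then extends to $C^*(G)$ by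
density. The map $\Omega$ is composed from these pieces. -/

noncomputable section

namespace LCA


/-! ### Gelfand duality for commutative C*-algebras that need not be unital -/

section Gelfand

open WeakDual Unitization Filter
open scoped CStarAlgebra

variable {A : Type*} [NonUnitalCommCStarAlgebra A]

/-- The extension of a character of `A` to a character of the unitization. -/
def charExt (m : characterSpace ℂ A) : characterSpace ℂ A⁺¹ :=
  CharacterSpace.equivAlgHom.symm (Unitization.lift (CharacterSpace.toNonUnitalAlgHom m))

theorem charExt_apply (m : characterSpace ℂ A) (x : A⁺¹) : charExt m x = x.fst + m x.snd := by
  change Unitization.lift (CharacterSpace.toNonUnitalAlgHom m) x = _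
  rfl

theorem charExt_inr (m : characterSpace ℂ A) (a : A) : charExt m (a : A⁺¹) = m a := by
  simp [charExt_apply]

theorem exists_apply_ne_zero (m : characterSpace ℂ A) : ∃ a, m a ≠ 0 := by
  by_contra! h
  exact m.2.1 (ContinuousLinearMap.ext h)

/-- A character of $A^{+1}$ is fixed on the scalars, so its restriction to $A$ determines it; that
restriction is a character as soon as it is nonzero. -/
theorem mem_range_charExt {φ : characterSpace ℂ A⁺¹} :
    φ ∈ Set.range (charExt (A := A)) ↔ ∃ a : A, φ (a : A⁺¹) ≠ 0 := by
  constructor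
  · rintro ⟨m, rfl⟩
    obtain ⟨a, ha⟩ := exists_apply_ne_zero m
    exact ⟨a, by rwa [charExt_inr]⟩
  · rintro ⟨a, ha⟩
    let m : A →L[ℂ] ℂ :=
      { toFun := fun b => φ (b : A⁺¹)
        map_add' := fun b c => by rw [inr_add, map_add]
        map_smul' := fun r b => by rw [inr_smul, map_smul, RingHom.id_apply]
        cont := (map_continuous φ).comp isometry_inr.continuous }
    refine ⟨⟨StrongDual.toWeakDual m, ?_, fun b c => ?_⟩, ?_⟩
    · intro h
      exact ha (DFunLike.congr_fun h a)
    · change φ ((b * c : A) : A⁺¹) = _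
      rw [inr_mul, map_mul]
      rfl
    · ext x
      rw [charExt_apply]
      nth_rw 3 [← inl_fst_add_inr_snd_eq x]
      rw [map_add]
      congr 1
      have := AlgHomClass.commutes φ x.fst
      rw [algebraMap_eq_inl] at this
      exact this.symm

theorem isOpen_range_charExt : IsOpen (Set.range (charExt (A := A))) := by
  have : Set.range (charExt (A := A)) = ⋃ a : A, {φ | φ (a : A⁺¹) ≠ 0} := by
    ext φ
    rw [mem_range_charExt, Set.mem_iUnion]
    rfl
  rw [this]
  refine isOpen_iUnion fun a => isOpen_ne_fun ?_ continuous_const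
  exact (WeakDual.eval_continuous (a : A⁺¹)).comp continuous_subtype_val

theorem continuous_char_apply (a : A) : Continuous fun m : characterSpace ℂ A => m a :=
  (WeakDual.eval_continuous a).comp continuous_subtype_val

theorem isOpenEmbedding_charExt : IsOpenEmbedding (charExt (A := A)) := by
  refine ⟨⟨?_, fun m n h => ?_⟩, isOpen_range_charExt⟩
  · refine isInducing_iff_nhds.2 fun m => le_antisymm ?_ ?_
    · refine tendsto_iff_comap.1 (Continuous.tendsto ?_ m)
      refine Continuous.subtype_mk (WeakDual.continuous_of_continuous_eval fun x => ?_) _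
      have : Continuous fun m : characterSpace ℂ A => x.fst + m x.snd :=
        continuous_const.add (continuous_char_apply _)
      exact this.congr fun m => (charExt_apply m x).symm
    -- The topology of $\Delta_A$ is that of pointwise convergence on $A$, and the value at $a$ can
    -- be read off from the extended character.
    · have h1 : Topology.IsInducing fun (n : characterSpace ℂ A) (a : A) => n a :=
        IsInducing.comp (g := fun (n : WeakDual ℂ A) (a : A) => n a) ⟨rfl⟩ IsInducing.subtypeVal
      rw [h1.nhds_eq_comap, ← tendsto_iff_comap, tendsto_pi_nhds]
      intro a
      have h2 : Continuous fun φ : characterSpace ℂ A⁺¹ => φ (a : A⁺¹) :=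
        (WeakDual.eval_continuous (a : A⁺¹)).comp continuous_subtype_val
      have h3 := (h2.tendsto (charExt m)).comp (tendsto_comap (f := charExt))
      simpa only [Function.comp_def, charExt_inr] using h3
  · ext a
    rw [← charExt_inr, h, charExt_inr]

/-- As $\varepsilon>0$, the condition $\varepsilon\le|\varphi(a)|$ excludes the character that kills
$A$. The set is therefore carried onto a closed subset of the compact character space of $A^{+1}$.
-/
theorem isCompact_setOf_le_norm (a : A) {ε : ℝ} (hε : 0 < ε) :
    IsCompact {m : characterSpace ℂ A | ε ≤ ‖m a‖} := by
  rw [isOpenEmbedding_charExt.isInducing.isCompact_iff]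
  have : charExt '' {m : characterSpace ℂ A | ε ≤ ‖m a‖} = {φ | ε ≤ ‖φ (a : A⁺¹)‖} := by
    ext φ
    constructor
    · rintro ⟨m, hm, rfl⟩
      simpa only [Set.mem_ofPred_eq, charExt_inr] using hm
    · intro h
      obtain ⟨m, rfl⟩ := mem_range_charExt.2 ⟨a, norm_pos_iff.1 (hε.trans_le h)⟩
      exact ⟨m, by simpa only [Set.mem_ofPred_eq, charExt_inr] using h, rfl⟩
  rw [this]
  refine (isClosed_le continuous_const ?_).isCompact
  exact ((WeakDual.eval_continuous (a : A⁺¹)).comp continuous_subtype_val).norm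

theorem tendsto_zero_of_isCompact {X : Type*} [TopologicalSpace X] {f : X → ℂ}
    (h : ∀ ε > 0, IsCompact {x | ε ≤ ‖f x‖}) : Tendsto f (cocompact X) (𝓝 0) := by
  rw [Metric.tendsto_nhds]
  intro ε hε
  filter_upwards [(h ε hε).compl_mem_cocompact] with x hx
  simpa using hx

theorem isCompact_of_zeroAtInfty {X : Type*} [TopologicalSpace X] (F : C₀(X, ℂ)) {ε : ℝ}
    (hε : 0 < ε) : IsCompact {x | ε ≤ ‖F x‖} := by
  have h := Metric.tendsto_nhds.1 F.zero_at_infty' ε hε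
  obtain ⟨K, hK, hKF⟩ := mem_cocompact.1 h
  refine hK.of_isClosed_subset (isClosed_le continuous_const (map_continuous F).norm) fun x hx => ?_
  by_contra hxK
  have h1 := hKF hxK
  simp only [Set.mem_ofPred_eq, dist_zero_right] at h1
  exact absurd hx (not_le.2 h1)

variable (A) in
/-- The Gelfand transform of a commutative C*-algebra which need not be unital. -/
def gelfandHom : A →⋆ₙₐ[ℂ] C₀(characterSpace ℂ A, ℂ) where
  toFun a := ⟨⟨fun m => m a, continuous_char_apply a⟩,
    tendsto_zero_of_isCompact fun _ hε => isCompact_setOf_le_norm a hε⟩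
  map_smul' c a := by ext m; exact map_smul m c a
  map_zero' := by ext m; exact map_zero m
  map_add' a b := by ext m; exact map_add m a b
  map_mul' a b := by ext m; exact map_mul m a b
  map_star' a := by
    ext m
    change m (star a) = star (m a)
    rw [← charExt_inr m, ← charExt_inr m, inr_star, map_star]

theorem gelfandHom_apply (a : A) (m : characterSpace ℂ A) : gelfandHom A a m = m a := rfl

theorem norm_char_apply_le (m : characterSpace ℂ A) (a : A) : ‖m a‖ ≤ ‖a‖ := by
  rw [← charExt_inr, ← norm_inr (𝕜 := ℂ) a]
  exact AlgHom.norm_apply_le_self (CharacterSpace.toAlgHom (charExt m)) _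

/-- The unital Gelfand transform is isometric, and the characters of $A^{+1}$ that do not come from
$A$ contribute only the value $0$ to the supremum. -/
theorem norm_gelfandHom (a : A) : ‖gelfandHom A a‖ = ‖a‖ := by
  refine le_antisymm ?_ ?_
  · rw [← ZeroAtInftyContinuousMap.norm_toBCF_eq_norm]
    exact (BoundedContinuousFunction.norm_le (norm_nonneg a)).2 fun m => norm_char_apply_le m a
  · have h : ‖gelfandTransform ℂ A⁺¹ (a : A⁺¹)‖ = ‖(a : A⁺¹)‖ :=
      (gelfandTransform_isometry A⁺¹).norm_map_of_map_zero (map_zero _) _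
    rw [← norm_inr (𝕜 := ℂ) a, ← h]
    refine (ContinuousMap.norm_le _ (norm_nonneg _)).2 fun φ => ?_
    change ‖φ (a : A⁺¹)‖ ≤ _
    by_cases hφ : φ (a : A⁺¹) = 0
    · simp [hφ]
    · obtain ⟨m, rfl⟩ := mem_range_charExt.2 ⟨a, hφ⟩
      rw [charExt_inr, ← gelfandHom_apply, ← ZeroAtInftyContinuousMap.norm_toBCF_eq_norm]
      exact (gelfandHom A a).toBCF.norm_coe_le_norm m

/-- A function in `C₀` extends by zero along an open embedding. -/
theorem continuous_extend_zero {X Y : Type*} [TopologicalSpace X] [TopologicalSpace Y] [T2Space Y]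
    {e : X → Y} (he : IsOpenEmbedding e) (F : C₀(X, ℂ)) :
    Continuous (Function.extend e F 0) := by
  rw [continuous_iff_continuousAt]
  intro y
  by_cases hy : y ∈ Set.range e
  · obtain ⟨x, rfl⟩ := hy
    rw [← he.continuousAt_iff]
    rw [Function.extend_comp he.injective]
    exact (map_continuous F).continuousAt
  · rw [ContinuousAt, Function.extend_apply' _ _ _ hy, Pi.zero_apply, Metric.tendsto_nhds]
    intro ε hε
    -- Off the range the extension is $0$; it is smaller than $\varepsilon$ outside the image of the
    -- compact set where $|F|\ge\varepsilon$, and that image is closed.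
    have hc := ((isCompact_of_zeroAtInfty F hε).image he.continuous).isClosed
    have hyc : y ∈ (e '' {x | ε ≤ ‖F x‖})ᶜ := fun ⟨x, _, hx⟩ => hy ⟨x, hx⟩
    filter_upwards [hc.isOpen_compl.mem_nhds hyc] with z hz
    by_cases hz' : z ∈ Set.range e
    · obtain ⟨x, rfl⟩ := hz'
      rw [he.injective.extend_apply, dist_zero_right]
      by_contra h
      exact hz ⟨x, not_lt.1 h, rfl⟩
    · rw [Function.extend_apply' _ _ _ hz']
      simpa using hε

-- The extension of $F$ by zero is the transform of some $x\in A^{+1}$. Evaluation at the projection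
-- to the scalars, where the extension vanishes, shows that $x$ has no scalar part.
variable (A) in
theorem gelfandHom_surjective : Function.Surjective (gelfandHom A) := by
  intro F
  obtain ⟨x, hx⟩ := (gelfandTransform_bijective A⁺¹).2
    ⟨_, continuous_extend_zero (isOpenEmbedding_charExt (A := A)) F⟩
  have hx' : ∀ φ : characterSpace ℂ A⁺¹, φ x = Function.extend charExt F 0 φ :=
    fun φ => DFunLike.congr_fun hx φ
  have hfst : x.fst = 0 := by
    let φ : characterSpace ℂ A⁺¹ := CharacterSpace.equivAlgHom.symm (Unitization.fstHom ℂ A)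
    have h1 : ∀ y : A⁺¹, φ y = y.fst := fun y => rfl
    rw [← h1, hx', Function.extend_apply']
    · rfl
    · intro h
      obtain ⟨a, ha⟩ := mem_range_charExt.1 h
      exact ha (by rw [h1, fst_inr])
  refine ⟨x.snd, ?_⟩
  ext m
  rw [gelfandHom_apply]
  have := hx' (charExt m)
  rwa [charExt_apply, hfst, zero_add, isOpenEmbedding_charExt.injective.extend_apply] at this

theorem gelfandHom_isometry : Isometry (gelfandHom A) :=
  AddMonoidHomClass.isometry_of_norm _ norm_gelfandHom

variable (A) in
/-- The Gelfand isomorphism of a commutative C*-algebra which need not be unital. -/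
def gelfandEquiv : A ≃⋆ₐ[ℂ] C₀(characterSpace ℂ A, ℂ) :=
  StarAlgEquiv.ofBijective (gelfandHom A) ⟨gelfandHom_isometry.injective, gelfandHom_surjective A⟩

theorem gelfandEquiv_isometry : Isometry (gelfandEquiv A) := gelfandHom_isometry (A := A)

/-- Over an empty space $C_0$ is zero. This provides the one character of $C^*(G)$ from which the
bound at all characters is deduced. -/
theorem characterSpace_nonempty [Nontrivial A] : Nonempty (characterSpace ℂ A) := by
  obtain ⟨a, ha⟩ := exists_ne (0 : A)
  by_contra h
  rw [not_nonempty_iff] at h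
  exact ha ((gelfandEquiv A).injective (ZeroAtInftyContinuousMap.ext fun m => h.elim m))

end Gelfand

/-! ### Pullback of $C_0$-functions along a homeomorphism -/

section CompHomeomorph

variable {X Y : Type*} [TopologicalSpace X] [TopologicalSpace Y]

/-- Composition with a homeomorphism, as an isomorphism of algebras of functions. -/
def compHomeomorph (e : Y ≃ₜ X) : C₀(X, ℂ) ≃⋆ₐ[ℂ] C₀(Y, ℂ) where
  toFun F := F.comp e.toCocompactMap
  invFun F := F.comp e.symm.toCocompactMap
  left_inv F := by ext x; exact congrArg F (e.apply_symm_apply x)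
  right_inv F := by ext x; exact congrArg F (e.symm_apply_apply x)
  map_mul' _ _ := rfl
  map_add' _ _ := rfl
  map_star' _ := rfl
  map_smul' _ _ := rfl

theorem compHomeomorph_isometry (e : Y ≃ₜ X) : Isometry (compHomeomorph e) := by
  refine Isometry.of_dist_eq fun F H => ?_
  rw [← ZeroAtInftyContinuousMap.dist_toBCF_eq_dist, ← ZeroAtInftyContinuousMap.dist_toBCF_eq_dist]
  refine le_antisymm ?_ ?_
  · exact (BoundedContinuousFunction.dist_le dist_nonneg).2 fun y =>
      BoundedContinuousFunction.dist_coe_le_dist (f := F.toBCF) (g := H.toBCF) (e y)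
  · refine (BoundedContinuousFunction.dist_le dist_nonneg).2 fun x => ?_
    have := BoundedContinuousFunction.dist_coe_le_dist (f := (compHomeomorph e F).toBCF)
      (g := (compHomeomorph e H).toBCF) (e.symm x)
    change dist (F (e (e.symm x))) (H (e (e.symm x))) ≤ _ at this
    rwa [e.apply_symm_apply] at this

end CompHomeomorph


/-- Source of the witnesses that Fourier transforms, $L^2(G)$ and $C^*(G)$ do not vanish. -/
theorem exists_bump (X : Type*) [AddCommGroup X] [TopologicalSpace X] [IsTopologicalAddGroup X]
    [LocallyCompactSpace X] [T2Space X] :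
    ∃ b : X → ℝ, Continuous b ∧ HasCompactSupport b ∧ 0 ≤ b ∧ b 0 = 1 := by
  obtain ⟨b, h1, -, h3, h4⟩ := exists_continuous_one_zero_of_isCompact
    (isCompact_singleton (x := (0 : X))) isClosed_empty (Set.disjoint_empty _)
  exact ⟨b, b.continuous, h3, fun x => (h4 x).1, h1 rfl⟩

/-! ### Functionals on $L^1$ given by bounded continuous functions -/

section Pairing

open scoped BoundedContinuousFunction

variable {G : Type*} [TopologicalSpace G] [MeasurableSpace G] [BorelSpace G] (μ : Measure G)

theorem integrable_mul_bounded {f : G → ℂ} (hf : Integrable f μ) (k : G →ᵇ ℂ) :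
    Integrable (fun x => f x * k x) μ :=
  hf.mul_bdd (c := ‖k‖) k.continuous.aestronglyMeasurable
    (Filter.Eventually.of_forall k.norm_coe_le_norm)

/-- The functional `f ↦ ∫ f k` on `L¹` defined by a bounded continuous function `k`. -/
def pairing (k : G →ᵇ ℂ) : Lp ℂ 1 μ →L[ℂ] ℂ :=
  LinearMap.mkContinuous
    { toFun := fun f => ∫ x, f x * k x ∂μ
      map_add' := fun f g => by
        rw [← integral_add (integrable_mul_bounded μ (L1.integrable_coeFn f) k)
          (integrable_mul_bounded μ (L1.integrable_coeFn g) k)]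
        refine integral_congr_ae ?_
        filter_upwards [Lp.coeFn_add f g] with x hx
        rw [hx, Pi.add_apply, add_mul]
      map_smul' := fun c f => by
        rw [RingHom.id_apply, smul_eq_mul, ← integral_const_mul]
        refine integral_congr_ae ?_
        filter_upwards [Lp.coeFn_smul c f] with x hx
        rw [hx, Pi.smul_apply, smul_eq_mul, mul_assoc] }
    ‖k‖ (fun f => by
      rw [L1.norm_eq_integral_norm, mul_comm, ← integral_mul_const]
      refine norm_integral_le_of_norm_le ((L1.integrable_coeFn f).norm.mul_const _)
        (Filter.Eventually.of_forall fun y => ?_)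
      rw [norm_mul]
      gcongr
      exact k.norm_coe_le_norm y)

theorem pairing_apply (k : G →ᵇ ℂ) (f : Lp ℂ 1 μ) : pairing μ k f = ∫ x, f x * k x ∂μ := rfl

theorem norm_pairing_le (k : G →ᵇ ℂ) : ‖pairing μ k‖ ≤ ‖k‖ :=
  LinearMap.mkContinuous_norm_le _ (norm_nonneg k) _

theorem pairing_toL1 (k : G →ᵇ ℂ) {f : G → ℂ} (hf : Integrable f μ) :
    pairing μ k (hf.toL1 f) = ∫ x, f x * k x ∂μ := by
  rw [pairing_apply]
  refine integral_congr_ae ?_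
  filter_upwards [hf.coeFn_toL1] with x hx
  rw [hx]

/-- The classes of compactly supported continuous functions in `L¹`. -/
def compactlySupported : Set (Lp ℂ 1 μ) :=
  {u | ∃ (d : G → ℂ) (h : Integrable d μ), Continuous d ∧ HasCompactSupport d ∧ h.toL1 d = u}

end Pairing

/-- Pointwise continuity of a bounded family of functionals can be tested on a dense set. -/
theorem continuous_apply_of_dense {X E : Type*} [TopologicalSpace X] [NormedAddCommGroup E]
    [NormedSpace ℂ E] {Φ : X → E →L[ℂ] ℂ} (hΦ : ∀ x f, ‖Φ x f‖ ≤ ‖f‖) {s : Set E}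
    (hs : Dense s) (h : ∀ f ∈ s, Continuous fun x => Φ x f) (f : E) :
    Continuous fun x => Φ x f := by
  refine continuous_of_uniform_approx_of_continuous fun u hu => ?_
  obtain ⟨ε, hε, hεu⟩ := Metric.mem_uniformity_dist.1 hu
  obtain ⟨g, hg, hfg⟩ := hs.exists_dist_lt f hε
  refine ⟨fun x => Φ x g, h g hg, fun x => hεu ?_⟩
  rw [dist_eq_norm, ← map_sub]
  exact (hΦ x _).trans_lt (by rwa [← dist_eq_norm])

/-! ### Convolution on $L^1(G)$ as an integral of translates -/

section ConvolutionAlgebra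

variable {G : Type*} [AddCommGroup G] [TopologicalSpace G] [IsTopologicalAddGroup G]
  [LocallyCompactSpace G] [T2Space G] [MeasurableSpace G] [BorelSpace G]
  (μ : Measure G) [μ.IsAddHaarMeasure] [μ.Regular]

open scoped BoundedContinuousFunction

theorem dense_compactlySupported : Dense (compactlySupported μ) := by
  refine Metric.dense_iff.2 fun f ε hε => ?_
  obtain ⟨g, hg, hg1, hg2⟩ := exists_approx μ ENNReal.one_ne_top (Lp.memLp f)
    (ENNReal.ofReal_pos.2 (half_pos hε)).ne'
  have hgi : Integrable g μ := hg1.integrable_of_hasCompactSupport hg2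
  refine ⟨hgi.toL1 g, ?_, g, hgi, hg1, hg2, rfl⟩
  rw [Metric.mem_ball, dist_comm, dist_eq_norm, Lp.norm_def]
  have h : eLpNorm (↑↑(f - hgi.toL1 g)) 1 μ = eLpNorm (↑↑f - g) 1 μ := by
    refine eLpNorm_congr_ae ?_
    filter_upwards [Lp.coeFn_sub f (hgi.toL1 g), hgi.coeFn_toL1] with x h1 h2
    rw [h1, Pi.sub_apply, Pi.sub_apply, h2]
  rw [h]
  calc _ ≤ (ENNReal.ofReal (ε / 2)).toReal := ENNReal.toReal_mono ENNReal.ofReal_ne_top hg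
    _ = ε / 2 := ENNReal.toReal_ofReal (half_pos hε).le
    _ < ε := half_lt_self hε

/-- Integrable functions are separated by bounded continuous functions. -/
theorem eq_of_pairing_eq {u v : Lp ℂ 1 μ} (h : ∀ k : G →ᵇ ℂ, pairing μ k u = pairing μ k v) :
    u = v := by
  rw [← sub_eq_zero, ← norm_le_zero_iff]
  refine le_of_forall_pos_le_add fun ε hε => ?_
  set w := u - v
  have hw : ∀ k : G →ᵇ ℂ, pairing μ k w = 0 := fun k => by rw [map_sub, h, sub_self]
  -- Three errors of size $\varepsilon/3$: the approximation of $w$ by $d$, the pairing of $d$ with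
  -- $k$, and the term $\delta\,\mu(\operatorname{supp}d)$.
  obtain ⟨_, ⟨d, hdi, hd1, hd2, rfl⟩, hd⟩ := (dense_compactlySupported μ).exists_dist_lt w
    (show 0 < ε / 3 by positivity)
  have hfin : μ (tsupport d) ≠ ∞ := hd2.isCompact.measure_lt_top.ne
  obtain ⟨δ, hδ, hδ'⟩ : ∃ δ : ℝ, 0 < δ ∧ δ * μ.real (tsupport d) ≤ ε / 3 := by
    refine ⟨ε / 3 / (μ.real (tsupport d) + 1), by positivity, ?_⟩
    rw [div_mul_eq_mul_div, div_le_iff₀ (by positivity)]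
    gcongr
    linarith
  have hpos : ∀ x, 0 < max ‖d x‖ δ := fun x => lt_max_of_lt_right hδ
  -- A continuous substitute for the phase $\bar d/|d|$: it has norm at most $1$, and
  -- $dk=|d|^2/\max(|d|,\delta)\ge|d|-\delta$, so that $\int dk$ nearly equals $\|d\|_1$.
  let k : G →ᵇ ℂ := BoundedContinuousFunction.ofNormedAddCommGroup
    (fun x => conj (d x) / (max ‖d x‖ δ : ℝ)) (by
      refine Continuous.div (by fun_prop) (by fun_prop) fun x => ?_
      exact_mod_cast (hpos x).ne') 1 (fun x => by
        rw [norm_div, RCLike.norm_conj, Complex.norm_real, Real.norm_of_nonneg (hpos x).le]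
        exact div_le_one_of_le₀ (le_max_left _ _) (hpos x).le)
  have hk : ‖k‖ ≤ 1 := BoundedContinuousFunction.norm_ofNormedAddCommGroup_le _ zero_le_one _
  have hint : Integrable (fun x => ‖d x‖ ^ 2 / max ‖d x‖ δ) μ := by
    refine Continuous.integrable_of_hasCompactSupport ?_ ?_
    · exact Continuous.div (by fun_prop) (by fun_prop) fun x => (hpos x).ne'
    · refine hd2.mono fun x hx => ?_
      contrapose! hx
      simp only [Function.mem_support, not_not] at hx ⊢
      simp [hx]
  have h1 : pairing μ k (hdi.toL1 d) = ((∫ x, ‖d x‖ ^ 2 / max ‖d x‖ δ ∂μ : ℝ) : ℂ) := by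
    rw [pairing_toL1, ← integral_complex_ofReal]
    congr 1
    funext x
    change d x * (conj (d x) / (max ‖d x‖ δ : ℝ)) = _
    rw [mul_div_assoc', Complex.mul_conj, Complex.normSq_eq_norm_sq]
    push_cast
    rfl
  have h2 : ‖pairing μ k (hdi.toL1 d)‖ ≤ ε / 3 := by
    have : pairing μ k (hdi.toL1 d) = - pairing μ k (w - hdi.toL1 d) := by
      rw [map_sub, hw, zero_sub, neg_neg]
    rw [this, norm_neg]
    refine ((pairing μ k).le_opNorm _).trans ?_
    calc _ ≤ 1 * ‖w - hdi.toL1 d‖ := by gcongr; exact (norm_pairing_le μ k).trans hk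
      _ ≤ ε / 3 := by rw [one_mul, ← dist_eq_norm]; exact hd.le
  have h3 : ‖hdi.toL1 d‖ ≤ ε / 3 + ε / 3 := by
    rw [L1.norm_of_fun_eq_integral_norm]
    have h4 : ∫ x, ‖d x‖ ∂μ ≤ ∫ x, (‖d x‖ ^ 2 / max ‖d x‖ δ +
        (tsupport d).indicator (fun _ => δ) x) ∂μ := by
      refine integral_mono hdi.norm (hint.add ?_) fun x => ?_
      · exact (integrable_indicator_iff hd2.isCompact.isClosed.measurableSet).2
          (integrableOn_const hfin)
      · by_cases hx : x ∈ tsupport d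
        · simp only [Set.indicator_of_mem hx]
          rcases le_total ‖d x‖ δ with hl | hl
          · have : 0 ≤ ‖d x‖ ^ 2 / max ‖d x‖ δ := by positivity
            linarith
          · rw [max_eq_left hl, sq, mul_self_div_self]
            linarith
        · have : d x = 0 := image_eq_zero_of_notMem_tsupport hx
          simp [Set.indicator_of_notMem hx, this]
    rw [integral_add hint ((integrable_indicator_iff hd2.isCompact.isClosed.measurableSet).2
      (integrableOn_const hfin)), integral_indicator_const _
      hd2.isCompact.isClosed.measurableSet, smul_eq_mul, mul_comm _ δ] at h4
    rw [h1, Complex.norm_real] at h2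
    have := (le_abs_self _).trans h2
    linarith
  calc ‖w‖ ≤ ‖w - hdi.toL1 d‖ + ‖hdi.toL1 d‖ := by
        simpa using norm_add_le (w - hdi.toL1 d) (hdi.toL1 d)
    _ ≤ ε / 3 + (ε / 3 + ε / 3) := by
        rw [← dist_eq_norm]; exact add_le_add hd.le h3
    _ = 0 + ε := by ring

/-- The translation operator on `L¹(G)`. -/
def translationL1 (y : G) : Lp ℂ 1 μ →ₗᵢ[ℂ] Lp ℂ 1 μ :=
  Lp.compMeasurePreservingₗᵢ ℂ (fun x => x - y) (measurePreserving_sub_right μ y)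

theorem translationL1_ae (y : G) (f : Lp ℂ 1 μ) :
    translationL1 μ y f =ᵐ[μ] fun x => f (x - y) :=
  Lp.coeFn_compMeasurePreserving _ _

theorem translationL1_add (y z : G) (f : Lp ℂ 1 μ) :
    translationL1 μ (y + z) f = translationL1 μ y (translationL1 μ z f) := by
  refine Lp.ext ?_
  filter_upwards [translationL1_ae μ (y + z) f, translationL1_ae μ y (translationL1 μ z f),
    (measurePreserving_sub_right μ y).quasiMeasurePreserving.ae (translationL1_ae μ z f)]
    with x h1 h2 h3
  rw [h1, h2, h3]
  congr 1
  abel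

theorem translationL1_zero (f : Lp ℂ 1 μ) : translationL1 μ 0 f = f := by
  refine Lp.ext ?_
  filter_upwards [translationL1_ae μ 0 f] with x h1
  rw [h1, sub_zero]

theorem continuous_translationL1 (f : Lp ℂ 1 μ) :
    Continuous fun y : G => translationL1 μ y f := by
  have h : (fun y : G => translationL1 μ y f) = fun y : G => DomAddAct.mk (-y) +ᵥ f := by
    funext y
    refine Lp.ext ?_
    filter_upwards [translationL1_ae μ y f, DomAddAct.vadd_Lp_ae_eq (DomAddAct.mk (-y)) f]
      with x h1 h2
    rw [h1, h2]
    simp [sub_eq_neg_add]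
  rw [h]
  have : Fact ((1 : ℝ≥0∞) ≠ ∞) := ⟨by simp⟩
  exact (DomAddAct.continuous_mk.comp continuous_neg).vadd continuous_const

theorem integral_translationL1 (y : G) (f : Lp ℂ 1 μ) (k : G → ℂ) :
    ∫ x, translationL1 μ y f x * k x ∂μ = ∫ x, f x * k (x + y) ∂μ := by
  rw [← integral_sub_right_eq_self (fun x => f x * k (x + y)) y]
  refine integral_congr_ae ?_
  filter_upwards [translationL1_ae μ y f] with x hx
  rw [hx, sub_add_cancel]

/-- The bounded continuous function `y ↦ m (T_y f)`. -/
def orbit (m : Lp ℂ 1 μ →L[ℂ] ℂ) (f : Lp ℂ 1 μ) : G →ᵇ ℂ :=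
  BoundedContinuousFunction.ofNormedAddCommGroup (fun y => m (translationL1 μ y f))
    (m.continuous.comp (continuous_translationL1 μ f)) (‖m‖ * ‖f‖) (fun y => by
      simpa using m.le_opNorm (translationL1 μ y f))

theorem orbit_apply (m : Lp ℂ 1 μ →L[ℂ] ℂ) (f : Lp ℂ 1 μ) (y : G) :
    orbit μ m f y = m (translationL1 μ y f) := rfl

theorem pairing_conv (k : G →ᵇ ℂ) (f g : Lp ℂ 1 μ) :
    pairing μ k (conv μ f g) = ∫ y, g y * ∫ x, f x * k (x + y) ∂μ ∂μ := by
  rw [← (conv_main μ (L1.integrable_coeFn f) (L1.integrable_coeFn g)).2 k k.continuous ‖k‖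
    k.norm_coe_le_norm, pairing_apply]
  refine integral_congr_ae ?_
  filter_upwards [conv_ae μ f g] with x hx
  rw [hx]

/-- Convolution with a compactly supported continuous function is an integral of translates. -/
theorem conv_toL1 (f : Lp ℂ 1 μ) {g : G → ℂ} (hg : Continuous g) (hg' : HasCompactSupport g)
    (hgi : Integrable g μ) :
    Integrable (fun y => g y • translationL1 μ y f) μ ∧
      conv μ f (hgi.toL1 g) = ∫ y, g y • translationL1 μ y f ∂μ := by
  have hi : Integrable (fun y => g y • translationL1 μ y f) μ :=
    (hg.smul (continuous_translationL1 μ f)).integrable_of_hasCompactSupport hg'.smul_right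
  -- Paired with $k$, both sides become $\int g(y)\int f(x)k(x+y)\,dx\,dy$.
  refine ⟨hi, eq_of_pairing_eq μ fun k => ?_⟩
  rw [← ContinuousLinearMap.integral_comp_comm _ hi, pairing_conv]
  refine integral_congr_ae ?_
  filter_upwards [hgi.coeFn_toL1] with y hy
  rw [hy, map_smul, smul_eq_mul, pairing_apply, integral_translationL1]

/-- For $g$ continuous with compact support, $m$ passes under the integral $f\star g=\int
g(y)\,T_yf\,dy$; both sides are continuous in $g$. This stands in for representing $m$ by an
$L^\infty$ function, which is delicate when Haar measure is not $\sigma$-finite. -/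
theorem map_conv (m : Lp ℂ 1 μ →L[ℂ] ℂ) (hm : ∀ f g, m (conv μ f g) = m f * m g)
    (f g : Lp ℂ 1 μ) : m f * m g = pairing μ (orbit μ m f) g := by
  have h : Set.EqOn (fun g => m f * m g) (pairing μ (orbit μ m f)) (compactlySupported μ) := by
    rintro _ ⟨d, hdi, hd, hd', rfl⟩
    obtain ⟨h1, h2⟩ := conv_toL1 μ f hd hd' hdi
    simp only
    rw [← hm, h2, ← ContinuousLinearMap.integral_comp_comm _ h1, pairing_toL1]
    simp only [map_smul, smul_eq_mul, orbit_apply]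
  exact congrFun (Continuous.ext_on (dense_compactlySupported μ) (by fun_prop) (by fun_prop) h) g

/-- By `map_conv` and translation invariance, both sides equal $\int g(x)\,m(T_{x+y}f)\,dx$. -/
theorem map_translation_mul (m : Lp ℂ 1 μ →L[ℂ] ℂ) (hm : ∀ f g, m (conv μ f g) = m f * m g)
    (f g : Lp ℂ 1 μ) (y : G) : m (translationL1 μ y f) * m g = m f * m (translationL1 μ y g) := by
  rw [map_conv μ m hm, map_conv μ m hm, pairing_apply, pairing_apply, integral_translationL1]
  simp only [orbit_apply, translationL1_add]

end ConvolutionAlgebra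


/-! ### The dual group as the structure space of $L^1(G)$ -/

section DualGroup

open scoped BoundedContinuousFunction
open Multiplicative

variable {G : Type*} [AddCommGroup G] [TopologicalSpace G] [IsTopologicalAddGroup G]

theorem continuous_char (χ : PontryaginDual (Multiplicative G)) :
    Continuous fun x : G => (χ (ofAdd x) : ℂ) :=
  continuous_subtype_val.comp ((map_continuous χ).comp continuous_ofAdd)

theorem norm_char (χ : PontryaginDual (Multiplicative G)) (a : Multiplicative G) :
    ‖(χ a : ℂ)‖ = 1 := Circle.norm_coe _

/-- The bounded continuous function `x ↦ conj (χ x)`. -/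
def conjChar (χ : PontryaginDual (Multiplicative G)) : G →ᵇ ℂ :=
  BoundedContinuousFunction.ofNormedAddCommGroup (fun x => conj (χ (ofAdd x) : ℂ))
    (Complex.continuous_conj.comp (continuous_char χ)) 1
    (fun x => by rw [RCLike.norm_conj, norm_char])

theorem conjChar_apply (χ : PontryaginDual (Multiplicative G)) (x : G) :
    conjChar χ x = conj (χ (ofAdd x) : ℂ) := rfl

theorem conjChar_add (χ : PontryaginDual (Multiplicative G)) (x y : G) :
    conjChar χ (x + y) = conjChar χ x * conjChar χ y := by
  simp only [conjChar_apply, ofAdd_add, map_mul, Circle.coe_mul]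

theorem norm_conjChar_apply (χ : PontryaginDual (Multiplicative G)) (x : G) :
    ‖conjChar χ x‖ = 1 := by
  rw [conjChar_apply, RCLike.norm_conj, norm_char]

theorem norm_conjChar_le (χ : PontryaginDual (Multiplicative G)) : ‖conjChar χ‖ ≤ 1 :=
  BoundedContinuousFunction.norm_ofNormedAddCommGroup_le _ zero_le_one _

variable [LocallyCompactSpace G] [T2Space G] [MeasurableSpace G] [BorelSpace G]
  (μ : Measure G) [μ.IsAddHaarMeasure] [μ.Regular]

theorem fourier_eq (f : Lp ℂ 1 μ) (χ : PontryaginDual (Multiplicative G)) :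
    fourier μ f χ = pairing μ (conjChar χ) f := rfl

theorem norm_fourier_le (f : Lp ℂ 1 μ) (χ : PontryaginDual (Multiplicative G)) :
    ‖fourier μ f χ‖ ≤ ‖f‖ := by
  rw [fourier_eq]
  refine ((pairing μ (conjChar χ)).le_opNorm f).trans ?_
  exact mul_le_of_le_one_left (norm_nonneg f) ((norm_pairing_le μ _).trans (norm_conjChar_le χ))

theorem fourier_conv (f g : Lp ℂ 1 μ) (χ : PontryaginDual (Multiplicative G)) :
    fourier μ (conv μ f g) χ = fourier μ f χ * fourier μ g χ := by
  simp only [fourier_eq, pairing_conv, conjChar_add, ← mul_assoc]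
  simp only [integral_mul_const, ← pairing_apply]
  rw [pairing_apply μ (conjChar χ) g, ← integral_const_mul]
  congr 1
  funext y
  ring

theorem fourier_translation (y : G) (f : Lp ℂ 1 μ) (χ : PontryaginDual (Multiplicative G)) :
    fourier μ (translationL1 μ y f) χ = conjChar χ y * fourier μ f χ := by
  rw [fourier_eq, pairing_apply, integral_translationL1, fourier_eq, pairing_apply,
    ← integral_const_mul]
  congr 1
  funext x
  rw [conjChar_add]
  ring

/-- For a bump function $b$, the transform of $b\chi$ at $\chi$ is $\int b>0$. -/
theorem exists_fourier_ne_zero (χ : PontryaginDual (Multiplicative G)) :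
    ∃ f : Lp ℂ 1 μ, fourier μ f χ ≠ 0 := by
  obtain ⟨b, hb1, hb2, hb3, hb4⟩ := exists_bump G
  have hχ := continuous_char χ
  have hi : Integrable (fun x => (b x : ℂ) * (χ (ofAdd x) : ℂ)) μ := by
    refine Continuous.integrable_of_hasCompactSupport (by fun_prop) ?_
    refine hb2.mono fun x hx => ?_
    contrapose! hx
    simp only [Function.mem_support, not_not] at hx ⊢
    simp [hx]
  refine ⟨hi.toL1 _, ?_⟩
  rw [fourier_eq, pairing_toL1]
  have : ∀ x, (b x : ℂ) * (χ (ofAdd x) : ℂ) * conjChar χ x = (b x : ℂ) := fun x => by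
    rw [conjChar_apply, mul_assoc, Complex.mul_conj, Complex.normSq_eq_norm_sq, norm_char]
    simp
  simp only [this]
  rw [integral_complex_ofReal, Complex.ofReal_ne_zero]
  exact (hb1.integral_pos_of_hasCompactSupport_nonneg_nonzero hb2 hb3
    (x := 0) (by simp [hb4])).ne'

/-- The multiplicative functional on `L¹(G)` given by the Fourier transform at `χ`. -/
def fourierFunctional (χ : PontryaginDual (Multiplicative G)) : structureSpace μ :=
  ⟨StrongDual.toWeakDual (pairing μ (conjChar χ)), by
    refine ⟨fun h => ?_, fun f g => fourier_conv μ f g χ⟩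
    obtain ⟨f, hf⟩ := exists_fourier_ne_zero μ χ
    exact hf (DFunLike.congr_fun h f)⟩

/-- Recovers $\chi$ from its functional; both the injectivity of $M$ and the continuity of $M^{-1}$
rest on it. -/
theorem conjChar_eq_div {χ : PontryaginDual (Multiplicative G)} {f : Lp ℂ 1 μ}
    (hf : fourier μ f χ ≠ 0) (y : G) :
    conjChar χ y = fourier μ (translationL1 μ y f) χ / fourier μ f χ := by
  rw [fourier_translation, mul_div_cancel_right₀ _ hf]

theorem fourierFunctional_injective : Function.Injective (fourierFunctional μ) := by
  intro χ ψ h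
  have h' : ∀ f, fourier μ f χ = fourier μ f ψ := fun f =>
    DFunLike.congr_fun (congrArg Subtype.val h) f
  obtain ⟨f, hf⟩ := exists_fourier_ne_zero μ χ
  ext a
  have h1 := conjChar_eq_div μ hf (toAdd a)
  rw [h', h', ← conjChar_eq_div μ (by rwa [← h'])] at h1
  exact (starRingEnd ℂ).injective h1

/-- A bounded homomorphism to `ℂ` has values in the circle. -/
theorem norm_eq_one_of_bounded {H : Type*} [AddCommGroup H] {ψ : H → ℂ} (h0 : ψ 0 = 1)
    (hadd : ∀ x y, ψ (x + y) = ψ x * ψ y) {C : ℝ} (hC : ∀ x, ‖ψ x‖ ≤ C) (x : H) :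
    ‖ψ x‖ = 1 := by
  have hle : ∀ x, ‖ψ x‖ ≤ 1 := fun x => by
    -- If $|\psi(x)|>1$, then $|\psi(nx)|=|\psi(x)|^n$ is unbounded. The reverse inequality comes
    -- from $\psi(x)\psi(-x)=1$.
    by_contra! h
    have hpow : ∀ n : ℕ, ψ (n • x) = ψ x ^ n := fun n => by
      induction n with
      | zero => simp [h0]
      | succ n ih => rw [succ_nsmul, hadd, ih, pow_succ]
    obtain ⟨n, hn⟩ := pow_unbounded_of_one_lt C h
    exact (hC (n • x)).not_gt (by rwa [hpow, norm_pow])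
  refine le_antisymm (hle x) ?_
  have h1 : ‖ψ x‖ * ‖ψ (-x)‖ = 1 := by rw [← norm_mul, ← hadd, add_neg_cancel, h0, norm_one]
  nlinarith [hle (-x), norm_nonneg (ψ x), norm_nonneg (ψ (-x))]

theorem fourierFunctional_surjective : Function.Surjective (fourierFunctional μ) := by
  rintro ⟨m', hm0, hm⟩
  set m : Lp ℂ 1 μ →L[ℂ] ℂ := WeakDual.toStrongDual m'
  have hm : ∀ f g, m (conv μ f g) = m f * m g := hm
  obtain ⟨f, hf⟩ : ∃ f, m f ≠ 0 := by
    by_contra! h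
    exact hm0 (ContinuousLinearMap.ext h)
  -- The candidate for $\bar\chi$, as `conjChar_eq_div` dictates.
  let ψ : G → ℂ := fun y => m (translationL1 μ y f) / m f
  have hψ0 : ψ 0 = 1 := by simp only [ψ, translationL1_zero]; exact div_self hf
  have hψadd : ∀ y z, ψ (y + z) = ψ y * ψ z := fun y z => by
    have := map_translation_mul μ m hm f (translationL1 μ z f) y
    simp only [ψ, translationL1_add]
    field_simp
    linear_combination -this
  have hψc : Continuous ψ := ((orbit μ m f).continuous).div_const _
  have hψ1 : ∀ y, ‖ψ y‖ = 1 := norm_eq_one_of_bounded hψ0 hψadd (C := ‖m‖ * ‖f‖ / ‖m f‖)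
    fun y => by
      rw [norm_div]
      gcongr
      simpa using m.le_opNorm (translationL1 μ y f)
  let χ : PontryaginDual (Multiplicative G) := show Multiplicative G →ₜ* Circle from
    { toFun := fun y => ⟨conj (ψ (toAdd y)), by simp [Submonoid.unitSphere, hψ1]⟩
      map_one' := by ext; simp [hψ0]
      map_mul' := fun y z => by
        ext
        change conj (ψ (toAdd y + toAdd z)) = conj (ψ (toAdd y)) * conj (ψ (toAdd z))
        rw [hψadd, map_mul]
      continuous_toFun := by
        refine Continuous.subtype_mk ?_ _
        exact Complex.continuous_conj.comp (hψc.comp continuous_toAdd) }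
  refine ⟨χ, Subtype.ext (ContinuousLinearMap.ext fun g => ?_)⟩
  have h1 : ∀ y, conjChar χ y = ψ y := fun y => by
    rw [conjChar_apply]
    exact Complex.conj_conj _
  change pairing μ (conjChar χ) g = m g
  refine mul_left_cancel₀ hf ?_
  rw [map_conv μ m hm, pairing_apply, pairing_apply, ← integral_const_mul]
  congr 1
  funext y
  rw [h1, orbit_apply]
  simp only [ψ]
  field_simp

/-- The bound $|\widehat f(\chi)|\le\|f\|_1$ reduces to $f$ continuous with compact support. There
the integrand is jointly continuous, since evaluation $\widehat G\times G\to S^1$ is so for locally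
compact $G$. -/
theorem continuous_fourier (f : Lp ℂ 1 μ) :
    Continuous fun χ : PontryaginDual (Multiplicative G) => fourier μ f χ := by
  refine continuous_apply_of_dense (Φ := fun χ => pairing μ (conjChar χ))
    (fun χ f => norm_fourier_le μ f χ) (dense_compactlySupported μ) ?_ f
  rintro _ ⟨d, hdi, hd, hd', rfl⟩
  simp only [pairing_toL1]
  rw [← continuousOn_univ]
  refine continuousOn_integral_of_compact_support hd'.isCompact ?_ ?_
  · have he : Continuous fun p : PontryaginDual (Multiplicative G) × G => p.1 (ofAdd p.2) := by
      have h1 : Continuous fun χ : PontryaginDual (Multiplicative G) =>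
          ContinuousMonoidHom.toContinuousMap χ := continuous_induced_dom
      have : LocallyCompactSpace (Multiplicative G) := ‹LocallyCompactSpace G›
      exact (ContinuousEval.continuous_eval (F := C(Multiplicative G, Circle))).comp
        ((h1.comp continuous_fst).prodMk (continuous_ofAdd.comp continuous_snd))
    refine Continuous.continuousOn ?_
    simp only [Function.uncurry_def, conjChar_apply]
    fun_prop
  · intro χ x _ hx
    rw [image_eq_zero_of_notMem_tsupport hx, zero_mul]

/-- The bijection between the dual group and the structure space of `L¹(G)`. -/
def dualEquiv : PontryaginDual (Multiplicative G) ≃ structureSpace μ :=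
  Equiv.ofBijective (fourierFunctional μ)
    ⟨fourierFunctional_injective μ, fourierFunctional_surjective μ⟩

theorem fourier_dualEquiv_symm (m : structureSpace μ) (f : Lp ℂ 1 μ) :
    fourier μ f ((dualEquiv μ).symm m) = m.1 f :=
  DFunLike.congr_fun (congrArg Subtype.val ((dualEquiv μ).apply_symm_apply m)) f

theorem norm_structureSpace_le (m : structureSpace μ) (f : Lp ℂ 1 μ) : ‖m.1 f‖ ≤ ‖f‖ := by
  rw [← fourier_dualEquiv_symm]
  exact norm_fourier_le μ f _

/-- Every $m$ in the structure space has norm at most $1$, so $|m(T_zf)-m(T_yf)|\le\|T_zf-T_yf\|$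
uniformly in $m$. -/
theorem continuous_structureSpace_translation (f : Lp ℂ 1 μ) :
    Continuous fun p : structureSpace μ × G => p.1.1 (translationL1 μ p.2 f) := by
  rw [continuous_iff_continuousAt]
  rintro ⟨m, y⟩
  have h1 : Filter.Tendsto (fun p : structureSpace μ × G => p.1.1 (translationL1 μ y f))
      (𝓝 (m, y)) (𝓝 (m.1 (translationL1 μ y f))) :=
    (((WeakDual.eval_continuous _).comp continuous_subtype_val).comp continuous_fst).tendsto (m, y)
  have h2 : Filter.Tendsto (fun p : structureSpace μ × G =>
      p.1.1 (translationL1 μ p.2 f) - p.1.1 (translationL1 μ y f)) (𝓝 (m, y)) (𝓝 0) := by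
    have h3 : Continuous fun p : structureSpace μ × G =>
        ‖translationL1 μ p.2 f - translationL1 μ y f‖ :=
      (((continuous_translationL1 μ f).comp continuous_snd).sub continuous_const).norm
    have h4 := h3.tendsto (m, y)
    rw [sub_self, norm_zero] at h4
    refine squeeze_zero_norm (fun p => ?_) h4
    rw [← map_sub]
    exact norm_structureSpace_le μ p.1 _
  simpa [ContinuousAt] using h2.add h1

/-- Near $m_0$ one $f$ with $m_0(f)\ne0$ serves for all $m$. The formula
$\chi_m(y)=\overline{m(T_yf)/m(f)}$ is jointly continuous there, which implies continuity into the
compact-open topology. -/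
theorem continuous_dualEquiv_symm : Continuous (dualEquiv μ).symm := by
  rw [continuous_iff_continuousAt]
  intro m₀
  obtain ⟨f, hf⟩ : ∃ f, m₀.1 f ≠ 0 := by
    by_contra! h
    exact m₀.2.1 (ContinuousLinearMap.ext h)
  have hU : IsOpen {m : structureSpace μ | m.1 f ≠ 0} :=
    isOpen_ne_fun ((WeakDual.eval_continuous f).comp continuous_subtype_val) continuous_const
  refine ContinuousOn.continuousAt ?_ (hU.mem_nhds hf)
  rw [continuousOn_iff_continuous_domRestrict]
  refine ContinuousMonoidHom.continuous_of_continuous_uncurry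
    (fun m : {m : structureSpace μ | m.1 f ≠ 0} => ((dualEquiv μ).symm m.1 : _ →ₜ* Circle)) ?_
  refine continuous_induced_rng.2 ?_
  have h : ∀ p : {m : structureSpace μ | m.1 f ≠ 0} × Multiplicative G,
      (((dualEquiv μ).symm p.1.1) p.2 : ℂ) =
        conj (p.1.1.1 (translationL1 μ (toAdd p.2) f) / p.1.1.1 f) := fun p => by
    have h1 : fourier μ f ((dualEquiv μ).symm p.1.1) ≠ 0 := by
      rw [fourier_dualEquiv_symm]; exact p.1.2
    have h2 := conjChar_eq_div μ h1 (toAdd p.2)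
    rw [fourier_dualEquiv_symm, fourier_dualEquiv_symm] at h2
    rw [← h2, conjChar_apply, Complex.conj_conj]
    rfl
  have hc : Continuous fun p : {m : structureSpace μ | m.1 f ≠ 0} × Multiplicative G =>
      conj (p.1.1.1 (translationL1 μ (toAdd p.2) f) / p.1.1.1 f) := by
    refine Complex.continuous_conj.comp (Continuous.div ?_ ?_ fun p => p.1.2)
    · exact (continuous_structureSpace_translation μ f).comp
        ((continuous_subtype_val.comp continuous_fst).prodMk (continuous_toAdd.comp continuous_snd))
    · exact (WeakDual.eval_continuous f).comp
        (continuous_subtype_val.comp (continuous_subtype_val.comp continuous_fst))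
  exact hc.congr fun p => (h p).symm

/-- The dual group is homeomorphic to the structure space of `L¹(G)`. -/
def dualHomeomorph : PontryaginDual (Multiplicative G) ≃ₜ structureSpace μ where
  toEquiv := dualEquiv μ
  continuous_toFun := Continuous.subtype_mk
    (WeakDual.continuous_of_continuous_eval fun f => continuous_fourier μ f) _
  continuous_invFun := continuous_dualEquiv_symm μ

theorem dualHomeomorph_apply (χ : PontryaginDual (Multiplicative G)) (f : Lp ℂ 1 μ) :
    (dualHomeomorph μ χ).1 f = fourier μ f χ := rfl

end DualGroup


/-! ### Modulation by characters on $L^p(G)$ -/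

section Modulation

open Multiplicative

variable {G : Type*} [AddCommGroup G] [TopologicalSpace G] [IsTopologicalAddGroup G]
  [MeasurableSpace G] [BorelSpace G] (μ : Measure G)

theorem memLp_conjChar_mul (χ : PontryaginDual (Multiplicative G)) {p : ℝ≥0∞} {f : G → ℂ}
    (hf : MemLp f p μ) : MemLp (fun x => conjChar χ x * f x) p μ := by
  refine hf.of_le ((conjChar χ).continuous.aestronglyMeasurable.mul hf.1)
    (Filter.Eventually.of_forall fun x => ?_)
  rw [norm_mul, norm_conjChar_apply, one_mul]

/-- Multiplication by the conjugate of a character on `L^p(G)`. -/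
def modulation (p : ℝ≥0∞) (χ : PontryaginDual (Multiplicative G)) (f : Lp ℂ p μ) : Lp ℂ p μ :=
  (memLp_conjChar_mul μ χ (Lp.memLp f)).toLp _

theorem modulation_ae (p : ℝ≥0∞) (χ : PontryaginDual (Multiplicative G)) (f : Lp ℂ p μ) :
    modulation μ p χ f =ᵐ[μ] fun x => conjChar χ x * f x :=
  MemLp.coeFn_toLp _

theorem norm_modulation (p : ℝ≥0∞) (χ : PontryaginDual (Multiplicative G)) (f : Lp ℂ p μ) :
    ‖modulation μ p χ f‖ = ‖f‖ := by
  rw [Lp.norm_def, Lp.norm_def, eLpNorm_congr_ae (modulation_ae μ p χ f)]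
  congr 1
  refine eLpNorm_congr_norm_ae (Filter.Eventually.of_forall fun x => ?_)
  rw [norm_mul, norm_conjChar_apply, one_mul]

variable [μ.IsAddHaarMeasure]

/-- Modulation by $\chi^{-1}$ multiplies by $\chi$, and
$\overline{\chi(x)}\,\chi(x-y)=\overline{\chi(y)}$. -/
theorem inner_modulation_translation (χ : PontryaginDual (Multiplicative G)) (y : G)
    (φ ψ : Lp ℂ 2 μ) :
    ⟪modulation μ 2 χ⁻¹ φ, translation μ y (modulation μ 2 χ⁻¹ ψ)⟫_ℂ =
      conjChar χ y * ⟪φ, translation μ y ψ⟫_ℂ := by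
  rw [L2.inner_def, L2.inner_def, ← integral_const_mul]
  refine integral_congr_ae ?_
  filter_upwards [modulation_ae μ 2 χ⁻¹ φ, translation_ae μ y (modulation μ 2 χ⁻¹ ψ),
    translation_ae μ y ψ,
    (measurePreserving_sub_right μ y).quasiMeasurePreserving.ae (modulation_ae μ 2 χ⁻¹ ψ)]
    with x h1 h2 h3 h4
  rw [h1, h2, h4, h3]
  simp only [RCLike.inner_apply, map_mul]
  have h5 : conjChar χ⁻¹ x = conjChar χ⁻¹ (x - y) * conjChar χ⁻¹ y := by
    rw [← conjChar_add, sub_add_cancel]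
  have h6 : ∀ z, conjChar χ⁻¹ z * conj (conjChar χ⁻¹ z) = 1 := fun z => by
    rw [Complex.mul_conj, Complex.normSq_eq_norm_sq, norm_conjChar_apply]
    simp
  have h7 : conj (conjChar χ⁻¹ y) = conjChar χ y := by
    simp only [conjChar_apply, Complex.conj_conj]
    change (((χ (ofAdd y))⁻¹ : Circle) : ℂ) = _
    rw [Circle.coe_inv_eq_conj]
  rw [h5, map_mul, h7]
  linear_combination (conjChar χ y * ψ (x - y) * conj (φ x)) * h6 (x - y)

end Modulation

/-! ### The operators $\Psi_f$ and the commutative C*-algebra they generate -/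

section CStar

variable {G : Type*} [AddCommGroup G] [TopologicalSpace G] [IsTopologicalAddGroup G]
  [LocallyCompactSpace G] [T2Space G] [MeasurableSpace G] [BorelSpace G]
  (μ : Measure G) [μ.IsAddHaarMeasure] [μ.Regular]

theorem norm_le_of_inner_le {E : Type*} [NormedAddCommGroup E] [InnerProductSpace ℂ E]
    {T : E →L[ℂ] E} {C : ℝ} (hC : 0 ≤ C) (h : ∀ φ ψ, ‖⟪φ, T ψ⟫_ℂ‖ ≤ C * ‖φ‖ * ‖ψ‖) : ‖T‖ ≤ C := by
  refine T.opNorm_le_bound hC fun ψ => ?_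
  rcases (norm_nonneg (T ψ)).eq_or_lt with h0 | h0
  · rw [← h0]
    positivity
  · have h1 := h (T ψ) ψ
    rw [inner_self_eq_norm_sq_to_K, norm_pow, RCLike.norm_ofReal, abs_norm] at h1
    exact le_of_mul_le_mul_right (by linarith) h0

theorem norm_convOp_le (f : Lp ℂ 1 μ) : ‖convOp μ f‖ ≤ ‖f‖ := by
  refine norm_le_of_inner_le (norm_nonneg f) fun φ ψ => ?_
  rw [inner_convOp, L1.norm_eq_integral_norm, mul_assoc, ← integral_mul_const]
  refine norm_integral_le_of_norm_le ((L1.integrable_coeFn f).norm.mul_const _)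
    (Filter.Eventually.of_forall fun y => ?_)
  rw [norm_mul]
  gcongr
  simpa using norm_inner_le_norm φ (translation μ y ψ)

theorem inner_convOp_modulation (χ : PontryaginDual (Multiplicative G)) (f : Lp ℂ 1 μ)
    (φ ψ : Lp ℂ 2 μ) : ⟪φ, convOp μ (modulation μ 1 χ f) ψ⟫_ℂ =
      ⟪modulation μ 2 χ⁻¹ φ, convOp μ f (modulation μ 2 χ⁻¹ ψ)⟫_ℂ := by
  rw [inner_convOp, inner_convOp]
  refine integral_congr_ae ?_
  filter_upwards [modulation_ae μ 1 χ f] with y hy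
  rw [hy, inner_modulation_translation]
  ring

/-- $\Psi_{\bar\chi f}=U^*\Psi_fU$, where $U$ is the unitary multiplication by $\chi$ on $L^2(G)$.
-/
theorem norm_convOp_modulation_le (χ : PontryaginDual (Multiplicative G)) (f : Lp ℂ 1 μ) :
    ‖convOp μ (modulation μ 1 χ f)‖ ≤ ‖convOp μ f‖ := by
  refine norm_le_of_inner_le (norm_nonneg _) fun φ ψ => ?_
  rw [inner_convOp_modulation, ← norm_modulation μ 2 χ⁻¹ φ, ← norm_modulation μ 2 χ⁻¹ ψ]
  refine (norm_inner_le_norm _ _).trans ?_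
  rw [mul_right_comm, mul_comm]
  gcongr
  exact (convOp μ f).le_opNorm _

theorem fourier_modulation (χ ψ : PontryaginDual (Multiplicative G)) (f : Lp ℂ 1 μ) :
    fourier μ (modulation μ 1 χ f) ψ = fourier μ f (χ * ψ) := by
  refine integral_congr_ae ?_
  filter_upwards [modulation_ae μ 1 χ f] with x hx
  rw [hx, conjChar_apply]
  change _ = f x * conj (((χ (Multiplicative.ofAdd x) * ψ (Multiplicative.ofAdd x) : Circle)) : ℂ)
  rw [Circle.coe_mul, map_mul]
  ring

theorem exists_L2_ne_zero : ∃ φ : Lp ℂ 2 μ, φ ≠ 0 := by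
  obtain ⟨b, hb1, hb2, hb3, hb4⟩ := exists_bump G
  have hm : MemLp (fun x => (b x : ℂ)) 2 μ :=
    (Continuous.memLp_of_hasCompactSupport (by fun_prop)
      (hb2.comp_left (g := fun r : ℝ => (r : ℂ)) (by simp)))
  refine ⟨hm.toLp _, fun h => ?_⟩
  have h1 : (fun x => (b x : ℂ)) =ᵐ[μ] fun _ => 0 :=
    hm.coeFn_toLp.symm.trans ((Lp.eq_zero_iff_ae_eq_zero).1 h)
  have h2 := (Continuous.ae_eq_iff_eq μ (by fun_prop) continuous_const).1 h1
  have h3 := congrFun h2 0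
  simp [hb4] at h3

/-- With $c(y)=\langle\varphi|T_y\varphi\rangle$ and a bump function $b$, the choice $f=b\bar c$
gives $\langle\varphi|\Psi_f\varphi\rangle=\int b|c|^2>0$, because $c(0)=\|\varphi\|^2\neq0$. -/
theorem exists_convOp_ne_zero : ∃ f : Lp ℂ 1 μ, convOp μ f ≠ 0 := by
  obtain ⟨b, hb1, hb2, hb3, hb4⟩ := exists_bump G
  obtain ⟨φ, hφ⟩ := exists_L2_ne_zero μ
  obtain ⟨c, hc, hcφ⟩ : ∃ c : G → ℂ, Continuous c ∧ ∀ y, ⟪φ, translation μ y φ⟫_ℂ = c y :=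
    ⟨_, continuous_const.inner (continuous_translation μ φ), fun y => rfl⟩
  have hc0 : c 0 ≠ 0 := by
    rw [← hcφ, translation_zero]
    exact inner_self_ne_zero.2 hφ
  have hi : Integrable (fun y => (b y : ℂ) * conj (c y)) μ := by
    refine Continuous.integrable_of_hasCompactSupport (by fun_prop) ?_
    exact HasCompactSupport.mul_right (hb2.comp_left (g := fun r : ℝ => (r : ℂ)) (by simp))
  obtain ⟨f, hf⟩ : ∃ f : Lp ℂ 1 μ, f =ᵐ[μ] fun y => (b y : ℂ) * conj (c y) :=
    ⟨hi.toL1 _, hi.coeFn_toL1⟩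
  refine ⟨f, fun h => ?_⟩
  have h1 := inner_convOp μ f φ φ
  rw [h, zero_apply, inner_zero_right] at h1
  simp only [hcφ] at h1
  have h2 : ∫ y, f y * c y ∂μ = ((∫ y, b y * ‖c y‖ ^ 2 ∂μ : ℝ) : ℂ) := by
    rw [← integral_complex_ofReal]
    refine integral_congr_ae ?_
    filter_upwards [hf] with y hy
    rw [hy, mul_assoc, mul_comm (conj (c y)), Complex.mul_conj, Complex.normSq_eq_norm_sq]
    push_cast
    rfl
  rw [h2, eq_comm, Complex.ofReal_eq_zero] at h1
  have h3 : 0 < ∫ y, b y * ‖c y‖ ^ 2 ∂μ :=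
    Continuous.integral_pos_of_hasCompactSupport_nonneg_nonzero (x := 0)
      (hb1.mul (hc.norm.pow 2)) hb2.mul_right
      (fun y => mul_nonneg (hb3 y) (sq_nonneg _)) (by simp [hb4, hc0])
  exact h3.ne' h1

/-- The map `Ψ : L¹(G) → C*(G)` as a continuous linear map. -/
def psiCLM : Lp ℂ 1 μ →L[ℂ] groupCStar μ :=
  LinearMap.mkContinuous
    { toFun := Psi μ
      map_add' := fun f g => Subtype.ext (convOp_add μ f g).symm
      map_smul' := fun c f => Subtype.ext (convOp_smul μ c f).symm } 1
    (fun f => by rw [one_mul]; exact norm_convOp_le μ f)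

theorem Psi_conv (f g : Lp ℂ 1 μ) : Psi μ (conv μ f g) = Psi μ g * Psi μ f :=
  Subtype.ext (convOp_mul μ f g).symm

theorem denseRange_Psi : DenseRange (Psi μ) := by
  rintro ⟨a, ha⟩
  rw [IsInducing.subtypeVal.closure_eq_preimage_closure_image, Set.mem_preimage]
  have : Subtype.val '' Set.range (Psi μ) = Set.range (convOp μ) := by
    rw [← Set.range_comp]
    rfl
  exact this ▸ ha

theorem conv_comm (f g : Lp ℂ 1 μ) : conv μ f g = conv μ g f := by
  refine Lp.ext ?_
  filter_upwards [conv_ae μ f g, conv_ae μ g f] with x h1 h2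
  rw [h1, h2, ← integral_sub_left_eq_self (fun y => g (x - y) * f y) μ x]
  simp only [sub_sub_cancel, mul_comm]

/-- `C*(G)` is a commutative C*-algebra. -/
abbrev groupCStarCommCStar : NonUnitalCommCStarAlgebra (groupCStar μ) := by
  -- Being closed in $\mathcal B(L^2(G))$ makes the algebra complete.
  have hc : IsClosed (groupCStar μ : Set (Lp ℂ 2 μ →L[ℂ] Lp ℂ 2 μ)) :=
    (convOpRange μ).isClosed_topologicalClosure
  let _ : NonUnitalCommRing (groupCStar μ) :=
    (convOpRange μ).nonUnitalCommRingTopologicalClosure (by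
      rintro ⟨a, ha⟩ ⟨b, hb⟩
      obtain ⟨f, rfl⟩ : ∃ f, convOp μ f = a := ha
      obtain ⟨g, rfl⟩ : ∃ g, convOp μ g = b := hb
      refine Subtype.ext ?_
      change convOp μ f * convOp μ g = convOp μ g * convOp μ f
      rw [convOp_mul, convOp_mul, conv_comm])
  exact { }

end CStar


/-! ### The structure space of $C^*(G)$ and the isomorphism with $C_0(\widehat G)$ -/

section GroupCStar

open WeakDual

variable {G : Type*} [AddCommGroup G] [TopologicalSpace G] [IsTopologicalAddGroup G]
  [LocallyCompactSpace G] [T2Space G] [MeasurableSpace G] [BorelSpace G]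
  (μ : Measure G) [μ.IsAddHaarMeasure] [μ.Regular]

/-- The Gelfand isomorphism of `C*(G)`. -/
def groupCStarGelfand : groupCStar μ ≃⋆ₐ[ℂ] C₀(characterSpace ℂ (groupCStar μ), ℂ) :=
  letI := groupCStarCommCStar μ
  gelfandEquiv (groupCStar μ)

theorem groupCStarGelfand_apply (a : groupCStar μ) (m : characterSpace ℂ (groupCStar μ)) :
    groupCStarGelfand μ a m = m a := rfl

theorem groupCStarGelfand_isometry : Isometry (groupCStarGelfand μ) :=
  letI := groupCStarCommCStar μ
  gelfandEquiv_isometry (A := groupCStar μ)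

theorem norm_groupCStar_char_le (m : characterSpace ℂ (groupCStar μ)) (a : groupCStar μ) :
    ‖m a‖ ≤ ‖a‖ :=
  letI := groupCStarCommCStar μ
  norm_char_apply_le (A := groupCStar μ) m a

theorem nonempty_groupCStar_char : Nonempty (characterSpace ℂ (groupCStar μ)) := by
  let := groupCStarCommCStar μ
  have : Nontrivial (groupCStar μ) := by
    obtain ⟨f, hf⟩ := exists_convOp_ne_zero μ
    exact ⟨Psi μ f, 0, fun h => hf (congrArg Subtype.val h)⟩
  exact characterSpace_nonempty (A := groupCStar μ)

/-- Restriction of characters of `C*(G)` along `Ψ`. -/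
def charPsi (m : characterSpace ℂ (groupCStar μ)) : structureSpace μ :=
  ⟨StrongDual.toWeakDual ((CharacterSpace.toCLM m).comp (psiCLM μ)), by
    refine ⟨fun h => m.2.1 (ContinuousLinearMap.ext fun a => ?_), fun f g => ?_⟩
    · refine (denseRange_Psi μ).induction_on (p := fun a => m a = 0) a
        (isClosed_eq (map_continuous m) continuous_const) fun f => ?_
      exact DFunLike.congr_fun h f
    · change m (Psi μ (conv μ f g)) = m (Psi μ f) * m (Psi μ g)
      rw [Psi_conv, map_mul, mul_comm]⟩

theorem charPsi_apply (m : characterSpace ℂ (groupCStar μ)) (f : Lp ℂ 1 μ) :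
    (charPsi μ m).1 f = m (Psi μ f) := rfl

theorem charPsi_injective : Function.Injective (charPsi μ) := by
  intro m n h
  refine CharacterSpace.ext fun a => ?_
  refine (denseRange_Psi μ).induction_on (p := fun a => m a = n a) a
    (isClosed_eq (map_continuous m) (map_continuous n)) fun f => ?_
  exact DFunLike.congr_fun (congrArg Subtype.val h) f

/-- The Fourier transform is dominated by the norm of `C*(G)`. -/
theorem norm_fourier_le_norm_Psi (χ : PontryaginDual (Multiplicative G)) (f : Lp ℂ 1 μ) :
    ‖fourier μ f χ‖ ≤ ‖Psi μ f‖ := by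
  -- Any character of $C^*(G)$ gives the bound at its own $\chi_0$; modulation by $\chi\chi_0^{-1}$
  -- moves $\chi$ to $\chi_0$ without increasing the operator norm.
  obtain ⟨m⟩ := nonempty_groupCStar_char μ
  set χ₀ := (dualEquiv μ).symm (charPsi μ m)
  have h : ∀ g, fourier μ g χ₀ = m (Psi μ g) := fun g => by
    rw [fourier_dualEquiv_symm, charPsi_apply]
  have h1 : fourier μ f χ = fourier μ (modulation μ 1 (χ * χ₀⁻¹) f) χ₀ := by
    rw [fourier_modulation, inv_mul_cancel_right]
  rw [h1, h]
  exact (norm_groupCStar_char_le μ m _).trans (norm_convOp_modulation_le μ _ f)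

/-- By `norm_fourier_le_norm_Psi`, $\Psi_f\mapsto\widehat f(\chi)$ is well defined and bounded on a
dense subspace, so it extends to $C^*(G)$; multiplicativity passes to the closure. -/
theorem charPsi_surjective : Function.Surjective (charPsi μ) := by
  intro n
  set χ := (dualEquiv μ).symm n
  have hχ : ∀ f, fourier μ f χ = n.1 f := fourier_dualEquiv_symm μ n
  have : IsBoundedSMul ℂ (groupCStar μ) :=
    IsBoundedSMul.of_norm_smul_le fun c a => norm_smul_le c (a : Lp ℂ 2 μ →L[ℂ] Lp ℂ 2 μ)
  obtain ⟨m, hm⟩ : ∃ m : groupCStar μ →L[ℂ] ℂ, ∀ f, m (Psi μ f) = fourier μ f χ :=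
    ⟨(pairing μ (conjChar χ)).toLinearMap.extendOfNorm (psiCLM μ).toLinearMap,
      LinearMap.extendOfNorm_eq (denseRange_Psi μ)
        ⟨1, fun f => by rw [one_mul]; exact norm_fourier_le_norm_Psi μ χ f⟩⟩
  refine ⟨⟨StrongDual.toWeakDual m, ?_, ?_⟩, ?_⟩
  · intro h
    obtain ⟨f, hf⟩ := exists_fourier_ne_zero μ χ
    rw [← hm] at hf
    exact hf (DFunLike.congr_fun h _)
  · refine (denseRange_Psi μ).induction_on₂ (p := fun a b => m (a * b) = m a * m b)
      (isClosed_eq ?_ ?_) fun f g => ?_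
    · exact m.continuous.comp continuous_mul
    · exact (m.continuous.comp continuous_fst).mul (m.continuous.comp continuous_snd)
    · rw [← Psi_conv, hm, hm, hm, fourier_conv, mul_comm]
  · exact Subtype.ext (ContinuousLinearMap.ext fun f => (hm f).trans (hχ f))

/-- The bijection between the structure spaces of `C*(G)` and `L¹(G)`. -/
def charPsiEquiv : characterSpace ℂ (groupCStar μ) ≃ structureSpace μ :=
  Equiv.ofBijective (charPsi μ) ⟨charPsi_injective μ, charPsi_surjective μ⟩

/-- The structure spaces of `C*(G)` and `L¹(G)` are homeomorphic. -/
def charPsiHomeomorph : characterSpace ℂ (groupCStar μ) ≃ₜ structureSpace μ where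
  toEquiv := charPsiEquiv μ
  continuous_toFun := Continuous.subtype_mk (WeakDual.continuous_of_continuous_eval fun f =>
    (WeakDual.eval_continuous (Psi μ f)).comp continuous_subtype_val) _
  continuous_invFun := by
    refine Continuous.subtype_mk (f := fun m => ((charPsiEquiv μ).symm m).1)
      (WeakDual.continuous_of_continuous_eval fun a => ?_) _
    -- Characters of $C^*(G)$ have norm at most $1$, so testing on the dense set of the $\Psi_f$
    -- suffices; there the inverse evaluates to $m(f)$.
    refine continuous_apply_of_dense
      (Φ := fun m => CharacterSpace.toCLM ((charPsiEquiv μ).symm m))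
      (fun m a => norm_groupCStar_char_le μ _ a) (denseRange_Psi μ) ?_ a
    rintro _ ⟨f, rfl⟩
    have h : ∀ m, CharacterSpace.toCLM ((charPsiEquiv μ).symm m) (Psi μ f) = m.1 f := fun m =>
      DFunLike.congr_fun (congrArg Subtype.val ((charPsiEquiv μ).apply_symm_apply m)) f
    simp only [h]
    exact (WeakDual.eval_continuous f).comp continuous_subtype_val

theorem charPsiHomeomorph_apply (m : characterSpace ℂ (groupCStar μ)) (f : Lp ℂ 1 μ) :
    (charPsiHomeomorph μ m).1 f = m (Psi μ f) := rfl

/-- The isomorphism between `C₀` of the dual group and `C*(G)`. -/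
def groupCStarDual : C₀(PontryaginDual (Multiplicative G), ℂ) ≃⋆ₐ[ℂ] groupCStar μ :=
  (compHomeomorph ((charPsiHomeomorph μ).trans (dualHomeomorph μ).symm)).trans
    (groupCStarGelfand μ).symm

theorem groupCStarGelfand_groupCStarDual (F : C₀(PontryaginDual (Multiplicative G), ℂ)) :
    groupCStarGelfand μ (groupCStarDual μ F) =
      compHomeomorph ((charPsiHomeomorph μ).trans (dualHomeomorph μ).symm) F :=
  (groupCStarGelfand μ).apply_symm_apply _

theorem groupCStarDual_isometry : Isometry (groupCStarDual μ) :=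
  ((groupCStarGelfand_isometry μ).right_inv (groupCStarGelfand μ).apply_symm_apply).comp
    (compHomeomorph_isometry _)

end GroupCStar

end LCA
end

theorem mainTheorem2 {G : Type*} [AddCommGroup G] [TopologicalSpace G] [IsTopologicalAddGroup G]
    [LocallyCompactSpace G] [T2Space G] [MeasurableSpace G] [BorelSpace G]
    (μ : Measure G) [μ.IsAddHaarMeasure] [μ.Regular] :
    ∃ (M : PontryaginDual (Multiplicative G) ≃ₜ LCA.structureSpace μ)
      (PsiΔ : WeakDual.characterSpace ℂ (LCA.groupCStar μ) ≃ₜ LCA.structureSpace μ)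
      (Γ : LCA.groupCStar μ ≃⋆ₐ[ℂ] C₀(WeakDual.characterSpace ℂ (LCA.groupCStar μ), ℂ))
      (Ω : C₀(PontryaginDual (Multiplicative G), ℂ) ≃⋆ₐ[ℂ] LCA.groupCStar μ),
      (∀ χ f, (M χ).1 f = LCA.fourier μ f χ) ∧
      (∀ m f, (PsiΔ m).1 f = m (LCA.Psi μ f)) ∧
      (∀ a m, Γ a m = m a) ∧ Isometry Γ ∧
      Isometry Ω ∧
      ∀ F m, Γ (Ω F) m = F (M.symm (PsiΔ m)) := by
  refine ⟨LCA.dualHomeomorph μ, LCA.charPsiHomeomorph μ, LCA.groupCStarGelfand μ,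
    LCA.groupCStarDual μ, LCA.dualHomeomorph_apply μ, LCA.charPsiHomeomorph_apply μ,
    LCA.groupCStarGelfand_apply μ, LCA.groupCStarGelfand_isometry μ,
    LCA.groupCStarDual_isometry μ, fun F m => ?_⟩
  rw [LCA.groupCStarGelfand_groupCStarDual]
  rfl
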